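/- **Setting.** There are $k\ge 2$ labels $[k]$. Let $\mathcal C$ be the set of matrices $C\in\mathbb R^{k\times k}$ with $C[l,l]=0$, $C[l,r]\ge 0$ and $\sum_r C[l,r]=1$ for all $l,r$, and let $u^{l}_{\gamma}$ be the vector on $[k]$ with $u^{l}_{\gamma}[r]=\frac{1-\gamma}{k}+\gamma\mathbf 1(r=l)$. An online booster works with $N$ online learners $WL^1,\dots,WL^N$. In round $t$ an adversary picks $(x_t,y_t)\in\mathcal X\times[k]$ and reveals $x_t$; for $i=1,\dots,N$ the booster chooses $C^i_t\in\mathcal C$, sends $(x_t,C^i_t)$ to $WL^i$ and gets a prediction $l^i_t\in[k]$; then it makes a final prediction $\hat y_t\in[k]$; then $y_t$ is revealed and $WL^i$ receives $y_t$ with a weight $w^i_t\in[0,1]$. The booster is arbitrary: it may be randomized, $C^i_t$ may depend on all past rounds, on $x_t$ and on $l^1_t,\dots,l^{i-1}_t$, the weight $w^i_t$ moreover on $y_t$, and $\hat y_t$ may be any function of the past, $x_t$ and $l^1_t,\dots,l^N_t$ (for instance a weighted majority vote). The learners are randomized online algorithms with independent coins, also independent of the coins of the adversary and of the booster; the adversary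 is randomized and may depend on the learners' coins and on the booster's past final predictions. An adversary with a family of learners $(WL^i)_{i\ge1}$ satisfies the *online weak learning condition* with parameters $\delta,\gamma,S$ if for every $N$, every booster with $N$ learners (that is, every adaptive choice of the weights and cost matrices), every $T$ and every $i\le N$, with probability at least $1-\delta$, $$\sum_{t=1}^{T}w^i_t\,C^i_t[y_t,l^i_t]\;\le\;\sum_{t=1}^{T}\sum_{r=1}^{k}w^i_t\,C^i_t[y_t,r]\,u^{y_t}_{\gamma}[r]+S\;=\;\frac{1-\gamma}{k}\sum_{t=1}^{T}w^i_t+S .$$ Let $M_T=\#\{t\le T:\hat y_t\ne y_t\}$. **Theorem 2 (Lower bounds for $N$ and $T$).** There are absolute constants $c,\varepsilon_0>0$ such that the following holds. For any $k\ge2$, $\gamma\in(0,\frac14)$, $\delta\in(0,1)$, $\varepsilon\in(0,1)$ with $\varepsilon\le\varepsilon_0$, and $S\ge\frac{k\ln(1/\delta)}{\gamma}$, there exists an adversary with a family of learners $(WL^i)_{i\ge1}$ satisfying the online weak learning condition with parameters $\delta,\gamma,S$, such that for every $N\ge0$ and every online booster that uses the learners $WL^1,\dots,WL^N$: 1. if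 the booster reaches asymptotic error rate $\varepsilon$, even only in the sense that $\liminf_{T\to\infty}M_T/T\le\varepsilon$ with positive probability, then $N\ge c\,\frac{1}{k^2\gamma^2}\ln\frac1\varepsilon$; 2. if $T\ge1$ is a number of rounds after which the booster has error rate at most $\varepsilon$, in the sense that $M_T\le\varepsilon T$ with probability at least $\frac34$, then $T\ge c\,\frac{k}{\varepsilon\gamma}S$. -/

import Mathlib

open MeasureTheory

namespace OnlineBoosting

/-- A cost matrix: `C y l` is the cost of predicting `l` when the correct label is `y`. -/
abbrev CostMatrix (k : ℕ) : Type := Fin k → Fin k → ℝ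

/-- The cost matrices a booster may use: zero diagonal, nonnegative entries, and every row has
`ℓ¹`-norm one. -/
def IsAdmissibleCost {k : ℕ} (C : CostMatrix k) : Prop :=
  ∀ l : Fin k, C l l = 0 ∧ (∀ r : Fin k, 0 ≤ C l r) ∧ ∑ r : Fin k, |C l r| = 1

/-- The distribution on the labels that is uniform except for additional mass `γ` on `l`. -/
noncomputable def biasedUniform (k : ℕ) (γ : ℝ) (l : Fin k) : Fin k → ℝ :=
  fun r => (1 - γ) / k + if r = l then γ else 0

/-- A randomized online learner on the domain `X` with labels `Fin k`. In round `t` it sees its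
own coins, for each earlier round the example, the cost matrix, the revealed label and the
importance weight, and then the current example and cost matrix; it answers with a label.
(Its own earlier predictions are functions of these data.) -/
structure WeakLearner (X : Type) [MeasurableSpace X] (k : ℕ) where
  Coin : Type
  [measurableCoin : MeasurableSpace Coin]
  law : Measure Coin
  [isProbabilityMeasure_law : IsProbabilityMeasure law]
  predict : (t : ℕ) → Coin → (Fin t → X × CostMatrix k × Fin k × ℝ) → X → CostMatrix k → Fin k
  measurable_predict : ∀ t : ℕ, Measurable
    fun p : Coin × (Fin t → X × CostMatrix k × Fin k × ℝ) × X × CostMatrix k =>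
      predict t p.1 p.2.1 p.2.2.1 p.2.2.2

attribute [instance] WeakLearner.measurableCoin WeakLearner.isProbabilityMeasure_law

/-- A randomized adaptive adversary. In round `t` it picks a labeled example from its own coins,
the coins `R` of the learners it is paired with, and the booster's earlier final predictions. -/
structure Adversary (X : Type) [MeasurableSpace X] (k : ℕ) (R : Type) [MeasurableSpace R] where
  Coin : Type
  [measurableCoin : MeasurableSpace Coin]
  law : Measure Coin
  [isProbabilityMeasure_law : IsProbabilityMeasure law]
  draw : (t : ℕ) → Coin → R → (Fin t → Fin k) → X × Fin k
  measurable_draw : ∀ t : ℕ, Measurable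
    fun p : Coin × R × (Fin t → Fin k) => draw t p.1 p.2.1 p.2.2

attribute [instance] Adversary.measurableCoin Adversary.isProbabilityMeasure_law

/-- An adversary together with a family of learners on a common domain. The coins of the different
learners and of the adversary are independent. -/
structure Environment (k : ℕ) where
  X : Type
  [measurableX : MeasurableSpace X]
  learner : ℕ → WeakLearner X k
  adversary : Adversary X k ((i : ℕ) → (learner i).Coin)

attribute [instance] Environment.measurableX

/-- A randomized online booster that works with `N` learners. In round `t` it sees its own coins,
all earlier examples, labels and weak predictions, and the current example `x`. For the `i`-th
learner it chooses a cost matrix, using also the current predictions of the preceding learners,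
and, once the label has been revealed, a weight, using also that label. Its final prediction is an
arbitrary function of what it has seen by then; any weighted majority vote of the weak predictions
is a special case. -/
structure Booster (X : Type) [MeasurableSpace X] (k N : ℕ) where
  Coin : Type
  [measurableCoin : MeasurableSpace Coin]
  law : Measure Coin
  [isProbabilityMeasure_law : IsProbabilityMeasure law]
  cost : (t : ℕ) → Coin → (Fin t → X × Fin k × (Fin N → Fin k)) → X →
    (i : Fin N) → (Fin i → Fin k) → CostMatrix k
  weight : (t : ℕ) → Coin → (Fin t → X × Fin k × (Fin N → Fin k)) → X →
    (i : Fin N) → (Fin i → Fin k) → Fin k → ℝ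
  final : (t : ℕ) → Coin → (Fin t → X × Fin k × (Fin N → Fin k)) → X → (Fin N → Fin k) → Fin k
  cost_admissible : ∀ t ω past x i prev, IsAdmissibleCost (cost t ω past x i prev)
  weight_mem : ∀ t ω past x i prev y, weight t ω past x i prev y ∈ Set.Icc (0 : ℝ) 1
  measurable_cost : ∀ (t : ℕ) (i : Fin N), Measurable
    fun p : Coin × (Fin t → X × Fin k × (Fin N → Fin k)) × X × (Fin i → Fin k) =>
      cost t p.1 p.2.1 p.2.2.1 i p.2.2.2
  measurable_weight : ∀ (t : ℕ) (i : Fin N), Measurable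
    fun p : Coin × (Fin t → X × Fin k × (Fin N → Fin k)) × X × (Fin i → Fin k) × Fin k =>
      weight t p.1 p.2.1 p.2.2.1 i p.2.2.2.1 p.2.2.2.2
  measurable_final : ∀ t : ℕ, Measurable
    fun p : Coin × (Fin t → X × Fin k × (Fin N → Fin k)) × X × (Fin N → Fin k) =>
      final t p.1 p.2.1 p.2.2.1 p.2.2.2

attribute [instance] Booster.measurableCoin Booster.isProbabilityMeasure_law

/-- Everything that happens in one round. -/
structure Round (X : Type) (k N : ℕ) where
  x : X
  y : Fin k
  cost : Fin N → CostMatrix k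
  weight : Fin N → ℝ
  vote : Fin N → Fin k
  final : Fin k

/-- The labels obtained one after the other, when the `i`-th one is computed by `f i` from the
preceding ones. -/
def sequentialVotes {k N : ℕ} (f : (i : Fin N) → (Fin i → Fin k) → Fin k) (i : Fin N) : Fin k :=
  f i fun j => sequentialVotes f ⟨j, j.isLt.trans i.isLt⟩
termination_by i.val
decreasing_by exact j.isLt

/-- The first `i` entries of a vector of `N` labels. -/
def before {k N : ℕ} (v : Fin N → Fin k) (i : Fin N) : Fin i → Fin k :=
  fun j => v ⟨j, j.isLt.trans i.isLt⟩

namespace Environment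

variable {k : ℕ} (E : Environment k) {N : ℕ} (B : Booster E.X k N)

/-- The coins of the adversary, of the learners, and of the booster. -/
abbrev Sample : Type := E.adversary.Coin × ((i : ℕ) → (E.learner i).Coin) × B.Coin

/-- All coins are independent. -/
noncomputable def prob : Measure (E.Sample B) :=
  E.adversary.law.prod ((Measure.infinitePi fun i => (E.learner i).law).prod B.law)

/-- Round `t`, played after the rounds `h`. -/
def playRound (ω : E.Sample B) (t : ℕ) (h : Fin t → Round E.X k N) : Round E.X k N :=
  let x := (E.adversary.draw t ω.1 ω.2.1 fun s => (h s).final).1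
  let y := (E.adversary.draw t ω.1 ω.2.1 fun s => (h s).final).2
  let past : Fin t → E.X × Fin k × (Fin N → Fin k) := fun s => ((h s).x, (h s).y, (h s).vote)
  let vote : Fin N → Fin k := sequentialVotes fun i prev =>
    (E.learner i).predict t (ω.2.1 i)
      (fun s => ((h s).x, (h s).cost i, (h s).y, (h s).weight i)) x
      (B.cost t ω.2.2 past x i prev)
  { x := x
    y := y
    cost := fun i => B.cost t ω.2.2 past x i (before vote i)
    weight := fun i => B.weight t ω.2.2 past x i (before vote i) y
    vote := vote
    final := B.final t ω.2.2 past x vote }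

/-- The first `t` rounds of the game. -/
def history (ω : E.Sample B) : (t : ℕ) → Fin t → Round E.X k N
  | 0 => Fin.elim0
  | t + 1 => Fin.snoc (α := fun _ => Round E.X k N) (history ω t)
      (E.playRound B ω t (history ω t))

/-- Round `t` of the game (rounds are numbered from `0`). -/
def round (ω : E.Sample B) (t : ℕ) : Round E.X k N := E.playRound B ω t (E.history B ω t)

/-- The number of mistakes of the booster in the first `T` rounds. -/
def mistakes (ω : E.Sample B) (T : ℕ) : ℕ :=
  ((Finset.range T).filter fun t => (E.round B ω t).final ≠ (E.round B ω t).y).card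

/-- The online weak learning condition with parameters `δ`, `γ`, `S`: for any adaptive choice of
admissible cost matrices and of weights in `[0, 1]`, that is, whatever the booster does, and for any
sample length `T`, every learner in use has, with probability at least `1 - δ`, a cumulative
weighted cost at most that of random guessing with edge `γ` plus `S`. -/
def WeakLearningCondition (δ γ S : ℝ) : Prop :=
  ∀ (N : ℕ) (B : Booster E.X k N) (T : ℕ) (i : Fin N),
    1 - δ ≤ (E.prob B).real {ω |
      ∑ t ∈ Finset.range T,
          (E.round B ω t).weight i * (E.round B ω t).cost i (E.round B ω t).y
            ((E.round B ω t).vote i) ≤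
        ∑ t ∈ Finset.range T, ∑ r : Fin k,
          (E.round B ω t).weight i * (E.round B ω t).cost i (E.round B ω t).y r *
            biasedUniform k γ (E.round B ω t).y r
        + S}

/-- With positive probability the lower limit of the booster's average number of mistakes is at
most `ε`. This is a lenient way to reach the asymptotic error rate `ε`: it holds if the upper limit
is at most `ε` with positive probability, and also if, for some constants `b` and `p > 0`, the
number of mistakes in `T` rounds is at most `ε T + b` with probability at least `p` for every `T`. -/
def ReachesAsymptoticErrorRate (ε : ℝ) : Prop :=
  0 < (E.prob B).real
    {ω | Filter.liminf (fun T : ℕ => (E.mistakes B ω T : ℝ) / T) Filter.atTop ≤ ε}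

/-- With probability at least `3 / 4` the booster's error rate over the first `T` rounds is at
most `ε`. -/
def HasErrorRateAfter (T : ℕ) (ε : ℝ) : Prop :=
  3 / 4 ≤ (E.prob B).real {ω | (E.mistakes B ω T : ℝ) ≤ ε * T}

end Environment

end OnlineBoosting

/-! The hard environment is noise. Labels are uniform and independent over the rounds; given the
label, the votes are independent draws with edge `3γ`, whatever cost matrices are sent. The learners
must know their votes while the examples must not reveal them, for otherwise a booster could read
off the votes of infinitely many learners. So the examples carry the votes encrypted by one-time
pads, whose keys are the learners' coins (`maskedEnvironment`). For fixed votes the ciphertext is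
uniform (`measurePreserving_masked`), so by `lintegral_prob_le` it suffices to fix the examples and
the booster's coins and to study the law of labels and votes alone.

Number of learners: by Le Cam's two-point method, a guess from `N` votes errs with probability at
least `exp(-72Nkγ²)/4` (`le_sum_voteWeight_error`). This holds in every round given the past, so a
Chernoff bound and Borel–Cantelli keep the error rate away from zero
(`not_reachesAsymptoticErrorRate`).

Number of rounds: the allowance `S` pays for about `kS/(6γ)` initial rounds without any edge, in
which the booster can only guess. The edge `3γ`, instead of the required `γ`, leaves room for an
exponential supermartingale bound on the excess cost (`delayedLaw_excess_gt_le`). A constant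
fraction of errors in these rounds must be at most `εT`, whence the bound on `T`
(`le_of_hasErrorRateAfter`).

If `δ` is close to 1, `S` may be too small to pay for even one such round, yet one is still needed.
Therefore the edge is withheld only with probability `2/3` (`delayedLaw`): the failure probability
is then at most `2/3 + δ⁴/3 ≤ δ`, while the chance of a correct guess is still at most `2/3`, below
the `3/4` in the definition of the error rate. -/

namespace OnlineBoosting

/-! ### Finite sums: exponential moments of costs, and Le Cam's bound for guessing the label. -/

section LabelDistributions

variable {k : ℕ}

lemma biasedUniform_nonneg {g : ℝ} (hg : 0 ≤ g) (hg1 : g ≤ 1) (y r : Fin k) :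
    0 ≤ biasedUniform k g y r := by
  unfold biasedUniform
  have : 0 ≤ (1 - g) / k := div_nonneg (by linarith) (Nat.cast_nonneg k)
  split_ifs <;> linarith

lemma sum_biasedUniform [NeZero k] (g : ℝ) (y : Fin k) : ∑ r, biasedUniform k g y r = 1 := by
  have hk : (k : ℝ) ≠ 0 := Nat.cast_ne_zero.2 (NeZero.ne k)
  simp only [biasedUniform, Finset.sum_add_distrib, Finset.sum_const, Finset.card_univ,
    Fintype.card_fin, nsmul_eq_mul, Finset.sum_ite_eq', Finset.mem_univ, if_true]
  field_simp
  ring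

lemma sum_cost_mul_biasedUniform {C : CostMatrix k} (hC : IsAdmissibleCost C) (g : ℝ)
    (y : Fin k) : ∑ r, C y r * biasedUniform k g y r = (1 - g) / k := by
  obtain ⟨h0, hn, h1⟩ := hC y
  have h1' : ∑ r, C y r = 1 := by
    rw [← h1]; exact Finset.sum_congr rfl fun r _ => (abs_of_nonneg (hn r)).symm
  simp only [biasedUniform, mul_add, Finset.sum_add_distrib, ← Finset.sum_mul, h1', one_mul,
    mul_ite, mul_zero, Finset.sum_ite_eq', Finset.mem_univ, if_true, h0, zero_mul, add_zero]

lemma cost_le_one {C : CostMatrix k} (hC : IsAdmissibleCost C) (y r : Fin k) : C y r ≤ 1 := by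
  obtain ⟨-, hn, h1⟩ := hC y
  rw [← h1, ← abs_of_nonneg (hn r)]
  exact Finset.single_le_sum (f := fun r => |C y r|) (fun i _ => abs_nonneg _) (Finset.mem_univ r)

/-- With `x = lam * v` one has `exp x ≤ 1 + x + x²` on `[0, 1]`, and `v² ≤ v` makes this linear in
`v`, so that only the mean cost enters later. -/
lemma exp_mul_le_of_mem_Icc {lam v : ℝ} (hl : 0 ≤ lam) (hl1 : lam ≤ 1) (hv : 0 ≤ v) (hv1 : v ≤ 1) :
    Real.exp (lam * v) ≤ 1 + (lam + lam ^ 2) * v := by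
  have h := Real.abs_exp_sub_one_sub_id_le (x := lam * v) (by
    rw [abs_of_nonneg (mul_nonneg hl hv)]; exact mul_le_one₀ hl1 hv hv1)
  have h2 := (abs_le.1 h).2
  nlinarith [mul_nonneg (sq_nonneg lam) (mul_nonneg hv (sub_nonneg.2 hv1))]

/-- The exponential moment of the cost of a prediction with edge `g`. -/
lemma sum_biasedUniform_mul_exp_cost_le [NeZero k] {C : CostMatrix k} (hC : IsAdmissibleCost C)
    {g lam w : ℝ} (hg : 0 ≤ g) (hg1 : g ≤ 1) (hl : 0 ≤ lam) (hl1 : lam ≤ 1) (hw : 0 ≤ w)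
    (hw1 : w ≤ 1) (y : Fin k) :
    ∑ r, biasedUniform k g y r * Real.exp (lam * (w * C y r)) ≤
      Real.exp ((lam + lam ^ 2) * w * ((1 - g) / k)) := by
  have hC0 : ∀ r, 0 ≤ C y r := (hC y).2.1
  calc ∑ r, biasedUniform k g y r * Real.exp (lam * (w * C y r))
      ≤ ∑ r, biasedUniform k g y r * (1 + (lam + lam ^ 2) * (w * C y r)) := by
        refine Finset.sum_le_sum fun r _ => mul_le_mul_of_nonneg_left ?_
          (biasedUniform_nonneg hg hg1 y r)
        exact exp_mul_le_of_mem_Icc hl hl1 (mul_nonneg hw (hC0 r))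
          (mul_le_one₀ hw1 (hC0 r) (cost_le_one hC y r))
    _ = ∑ r, biasedUniform k g y r +
          (lam + lam ^ 2) * w * ∑ r, C y r * biasedUniform k g y r := by
        rw [Finset.mul_sum, ← Finset.sum_add_distrib]
        exact Finset.sum_congr rfl fun r _ => by ring
    _ ≤ _ := by
        rw [sum_biasedUniform, sum_cost_mul_biasedUniform hC, add_comm]
        exact Real.add_one_le_exp _

/-- The probability that the correct label is `y` and the votes of `n` learners with edge `g`
are `v`. -/
noncomputable def voteWeight (k n : ℕ) (g : ℝ) (y : Fin k) (v : Fin n → Fin k) : ℝ :=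
  (1 / k) * ∏ i, biasedUniform k g y (v i)

lemma voteWeight_nonneg {n : ℕ} {g : ℝ} (hg : 0 ≤ g) (hg1 : g ≤ 1) (y : Fin k)
    (v : Fin n → Fin k) : 0 ≤ voteWeight k n g y v :=
  mul_nonneg (by positivity) (Finset.prod_nonneg fun i _ => biasedUniform_nonneg hg hg1 y _)

lemma sum_prod_biasedUniform [NeZero k] (n : ℕ) (g : ℝ) (y : Fin k) :
    ∑ v : Fin n → Fin k, ∏ i, biasedUniform k g y (v i) = 1 := by
  rw [← Fintype.sum_pow, sum_biasedUniform, one_pow]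

lemma sum_voteWeight [NeZero k] (n : ℕ) (g : ℝ) :
    ∑ y, ∑ v : Fin n → Fin k, voteWeight k n g y v = 1 := by
  have hk : (k : ℝ) ≠ 0 := Nat.cast_ne_zero.2 (NeZero.ne k)
  simp only [voteWeight, ← Finset.mul_sum, sum_prod_biasedUniform]
  simp [hk]

/-- Votes without edge carry no information on the label. -/
lemma sum_voteWeight_zero_correct [NeZero k] (n : ℕ) (f : (Fin n → Fin k) → Fin k) :
    ∑ y, ∑ v : Fin n → Fin k, voteWeight k n 0 y v * (if f v = y then 1 else 0) = 1 / k := by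
  rw [Finset.sum_comm]
  have h : ∀ y r : Fin k, biasedUniform k 0 y r = 1 / k := fun y r => by simp [biasedUniform]
  simp only [voteWeight, h, mul_ite, mul_one, mul_zero, Finset.sum_ite_eq, Finset.mem_univ, if_true]
  rw [← Finset.mul_sum]
  have := sum_prod_biasedUniform (k := k) n 0 0
  simp only [h] at this
  rw [this, mul_one]

/-- The exponential moment of the excess cost of the last of `n + 1` learners, where the weight
and the cost matrix depend on the other votes. -/
lemma sum_voteWeight_mul_exp_cost_le [NeZero k] (n : ℕ) {g lam : ℝ} (hg : 0 ≤ g) (hg1 : g ≤ 1)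
    (hl : 0 ≤ lam) (hl1 : lam ≤ 1) (C : (Fin n → Fin k) → CostMatrix k)
    (w : (Fin n → Fin k) → Fin k → ℝ) (hC : ∀ p, IsAdmissibleCost (C p))
    (hw : ∀ p y, w p y ∈ Set.Icc (0 : ℝ) 1) (c b : ℝ)
    (hc : ∀ u ∈ Set.Icc (0 : ℝ) 1, (lam + lam ^ 2) * u * ((1 - g) / k) - lam * (u * c) ≤ b) :
    ∑ y, ∑ v : Fin (n + 1) → Fin k, voteWeight k (n + 1) g y v *
      Real.exp (lam * (w (Fin.init v) y * C (Fin.init v) y (v (Fin.last n)) -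
        w (Fin.init v) y * c)) ≤ Real.exp b := by
  have key : ∀ (y : Fin k) (p : Fin n → Fin k),
      ∑ r, biasedUniform k g y r * Real.exp (lam * (w p y * C p y r - w p y * c)) ≤
        Real.exp b := by
    intro y p
    have h := sum_biasedUniform_mul_exp_cost_le (hC p) hg hg1 hl hl1 (hw p y).1 (hw p y).2 y
    calc _ = (∑ r, biasedUniform k g y r * Real.exp (lam * (w p y * C p y r))) *
          Real.exp (-(lam * (w p y * c))) := by
          rw [Finset.sum_mul]
          refine Finset.sum_congr rfl fun r _ => ?_
          rw [mul_assoc, ← Real.exp_add]; congr 2; ring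
      _ ≤ Real.exp ((lam + lam ^ 2) * w p y * ((1 - g) / k)) *
          Real.exp (-(lam * (w p y * c))) := mul_le_mul_of_nonneg_right h (Real.exp_nonneg _)
      _ ≤ Real.exp b := by
          rw [← Real.exp_add, Real.exp_le_exp]
          linarith [hc _ (hw p y)]
  calc _ = ∑ y, ∑ p : Fin n → Fin k, voteWeight k n g y p *
        ∑ r, biasedUniform k g y r * Real.exp (lam * (w p y * C p y r - w p y * c)) := by
        refine Finset.sum_congr rfl fun y _ => ?_
        rw [← (Fin.snocEquiv fun _ => Fin k).sum_comp, Fintype.sum_prod_type, Finset.sum_comm]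
        refine Finset.sum_congr rfl fun p _ => ?_
        rw [Finset.mul_sum]
        refine Finset.sum_congr rfl fun r _ => ?_
        have hinit : Fin.init ((Fin.snocEquiv fun _ => Fin k) (r, p)) = p :=
          Fin.init_snoc (α := fun _ => Fin k) r p
        rw [hinit]
        simp only [Fin.snocEquiv_apply, Fin.snoc_last, voteWeight,
          Fin.prod_univ_castSucc, Fin.snoc_castSucc]
        ring
    _ ≤ ∑ y, ∑ p : Fin n → Fin k, voteWeight k n g y p * Real.exp b :=
        Finset.sum_le_sum fun y _ => Finset.sum_le_sum fun p _ =>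
          mul_le_mul_of_nonneg_left (key y p) (voteWeight_nonneg hg hg1 y p)
    _ = Real.exp b := by
        simp only [← Finset.sum_mul, sum_voteWeight, one_mul]

/-- The Bhattacharyya coefficient of two label distributions with edge `g`. -/
lemma exp_le_sum_sqrt_biasedUniform [NeZero k] {g : ℝ} (hg : 0 ≤ g) (hg1 : g ≤ 3 / 4)
    {y y' : Fin k} (hy : y ≠ y') :
    Real.exp (-(4 * k * g ^ 2)) ≤
      ∑ r, Real.sqrt (biasedUniform k g y r * biasedUniform k g y' r) := by
  have hk : (1 : ℝ) ≤ k := Nat.one_le_cast.2 (Nat.pos_of_ne_zero (NeZero.ne k))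
  set b := (1 - g) / k with hb
  set a := b + g with ha
  have hb0 : 0 ≤ b := div_nonneg (by linarith) (by linarith)
  have ha0 : 0 ≤ a := by linarith
  have hka : 1 ≤ k * a := by
    have : k * b = 1 - g := by rw [hb]; field_simp
    rw [ha, mul_add, this]; nlinarith
  have hsum : ∑ r, Real.sqrt (biasedUniform k g y r * biasedUniform k g y' r) =
      1 - (Real.sqrt a - Real.sqrt b) ^ 2 := by
    have h1 : ∀ r, Real.sqrt (biasedUniform k g y r * biasedUniform k g y' r) =
        b + ((if r = y then Real.sqrt (a * b) - b else 0) +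
          (if r = y' then Real.sqrt (a * b) - b else 0)) := by
      intro r
      unfold biasedUniform
      rw [← hb]
      by_cases h : r = y
      · have h' : r ≠ y' := fun h' => hy (h.symm.trans h')
        simp only [h, if_true, hy, if_false, add_zero, ← ha]; ring
      · by_cases h' : r = y'
        · subst h'
          simp only [h, if_true, if_false, add_zero, ← ha, mul_comm b a]; ring
        · simp only [h, h', if_false, add_zero, Real.sqrt_mul_self hb0]
    simp only [h1, Finset.sum_add_distrib, Finset.sum_const, Finset.card_univ, Fintype.card_fin,
      nsmul_eq_mul, Finset.sum_ite_eq', Finset.mem_univ, if_true]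
    have : k * b = 1 - g := by rw [hb]; field_simp
    rw [this, Real.sqrt_mul ha0, sub_sq, Real.sq_sqrt ha0, Real.sq_sqrt hb0, ha]; ring
  rw [hsum]
  set s := Real.sqrt a
  set t := Real.sqrt b
  have hs : s ^ 2 = a := Real.sq_sqrt ha0
  have ht : t ^ 2 = b := Real.sq_sqrt hb0
  have hs0 : 0 ≤ s := Real.sqrt_nonneg a
  have ht0 : 0 ≤ t := Real.sqrt_nonneg b
  have hts : t ≤ s := Real.sqrt_le_sqrt (by linarith)
  have hx1 : (s - t) ^ 2 ≤ g := by nlinarith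
  -- Here `s - t = g / (s + t)` and `(s + t)² ≥ a ≥ 1 / k`.
  have hx2 : (s - t) ^ 2 ≤ k * g ^ 2 := by
    have h3 : (s - t) ^ 2 * a ≤ g ^ 2 := by
      have : g = (s - t) * (s + t) := by nlinarith
      rw [this, mul_pow, ← hs]
      exact mul_le_mul_of_nonneg_left (by nlinarith) (sq_nonneg _)
    nlinarith [sq_nonneg (s - t)]
  set x := (s - t) ^ 2
  have hx0 : 0 ≤ x := sq_nonneg _
  -- Since `x ≤ g ≤ 3 / 4`, the quotient in `log (1 - x) ≥ -x / (1 - x)` is at most `4 * x`.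
  have hlog : -(4 * x) ≤ Real.log (1 - x) := by
    have h4 := Real.one_sub_inv_le_log_of_pos (x := 1 - x) (by linarith)
    have h5 : (1 - x)⁻¹ ≤ 1 + 4 * x := by
      rw [inv_le_iff_one_le_mul₀ (by linarith)]; nlinarith
    linarith
  calc Real.exp (-(4 * k * g ^ 2)) ≤ Real.exp (-(4 * x)) := Real.exp_le_exp.2 (by nlinarith)
    _ ≤ Real.exp (Real.log (1 - x)) := Real.exp_le_exp.2 hlog
    _ = 1 - x := Real.exp_log (by linarith)

/-- The overlap of two finite distributions is at least half of their squared Bhattacharyya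
coefficient. -/
lemma sq_sum_sqrt_le_two_mul_sum_min {ι : Type*} [Fintype ι] {p q : ι → ℝ} (hp : ∀ i, 0 ≤ p i)
    (hq : ∀ i, 0 ≤ q i) (hp1 : ∑ i, p i = 1) (hq1 : ∑ i, q i = 1) :
    (∑ i, Real.sqrt (p i * q i)) ^ 2 ≤ 2 * ∑ i, min (p i) (q i) := by
  have h0 : ∀ i, 0 ≤ min (p i) (q i) := fun i => le_min (hp i) (hq i)
  have h1 : ∀ i, 0 ≤ max (p i) (q i) := fun i => (hp i).trans (le_max_left _ _)
  calc (∑ i, Real.sqrt (p i * q i)) ^ 2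
      = (∑ i, Real.sqrt (min (p i) (q i)) * Real.sqrt (max (p i) (q i))) ^ 2 := by
        congr 1
        refine Finset.sum_congr rfl fun i _ => ?_
        rw [← Real.sqrt_mul (h0 i), min_mul_max]
    _ ≤ (∑ i, Real.sqrt (min (p i) (q i)) ^ 2) * ∑ i, Real.sqrt (max (p i) (q i)) ^ 2 :=
        Finset.sum_mul_sq_le_sq_mul_sq _ _ _
    _ = (∑ i, min (p i) (q i)) * ∑ i, max (p i) (q i) := by
        simp only [Real.sq_sqrt (h0 _), Real.sq_sqrt (h1 _)]
    _ ≤ (∑ i, min (p i) (q i)) * 2 := by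
        refine mul_le_mul_of_nonneg_left ?_ (Finset.sum_nonneg fun i _ => h0 i)
        calc ∑ i, max (p i) (q i) ≤ ∑ i, (p i + q i) :=
              Finset.sum_le_sum fun i _ => max_le_add_of_nonneg (hp i) (hq i)
          _ = 2 := by rw [Finset.sum_add_distrib, hp1, hq1]; norm_num
    _ = _ := mul_comm _ _

/-- A lower bound for the error probability of every rule that guesses the label from the votes of
`n` learners with edge `g`. -/
lemma le_sum_voteWeight_error (hk : 2 ≤ k) [NeZero k] (n : ℕ) {g : ℝ} (hg : 0 ≤ g)
    (hg1 : g ≤ 3 / 4) (f : (Fin n → Fin k) → Fin k) :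
    1 / 4 * Real.exp (-(8 * n * k * g ^ 2)) ≤
      ∑ y, ∑ v : Fin n → Fin k, voteWeight k n g y v * (if f v ≠ y then 1 else 0) := by
  have hk0 : (k : ℝ) ≠ 0 := Nat.cast_ne_zero.2 (NeZero.ne k)
  set P : Fin k → (Fin n → Fin k) → ℝ := fun y v => ∏ i, biasedUniform k g y (v i) with hP
  have hu : ∀ y r : Fin k, 0 ≤ biasedUniform k g y r := biasedUniform_nonneg hg (by linarith)
  have hP0 : ∀ y v, 0 ≤ P y v := fun y v => Finset.prod_nonneg fun i _ => hu y _
  set err : Fin k → ℝ := fun y => ∑ v, P y v * (if f v ≠ y then 1 else 0) with herr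
  set α := 1 / 2 * Real.exp (-(8 * n * k * g ^ 2)) with hα
  have hpair : ∀ y y' : Fin k, y ≠ y' → α ≤ err y + err y' := by
    intro y y' hy
    have hbc : Real.exp (-(4 * n * k * g ^ 2)) ≤ ∑ v, Real.sqrt (P y v * P y' v) := by
      have h1 : ∀ v, Real.sqrt (P y v * P y' v) =
          ∏ i, Real.sqrt (biasedUniform k g y (v i) * biasedUniform k g y' (v i)) := by
        intro v
        rw [hP, ← Finset.prod_mul_distrib, Real.sqrt_prod]
        exact fun i _ => mul_nonneg (hu _ _) (hu _ _)
      simp only [h1]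
      rw [← Fintype.sum_pow fun r => Real.sqrt (biasedUniform k g y r * biasedUniform k g y' r)]
      calc Real.exp (-(4 * n * k * g ^ 2)) = Real.exp (-(4 * k * g ^ 2)) ^ n := by
            rw [← Real.exp_nat_mul]; congr 1; ring
        _ ≤ _ := pow_le_pow_left₀ (Real.exp_nonneg _) (exp_le_sum_sqrt_biasedUniform hg hg1 hy) n
    have h2 := sq_sum_sqrt_le_two_mul_sum_min (hP0 y) (hP0 y') (sum_prod_biasedUniform n g y)
      (sum_prod_biasedUniform n g y')
    have h3 : Real.exp (-(8 * n * k * g ^ 2)) = Real.exp (-(4 * n * k * g ^ 2)) ^ 2 := by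
      rw [← Real.exp_nat_mul]; congr 1; push_cast; ring
    have h4 := pow_le_pow_left₀ (Real.exp_nonneg _) hbc 2
    have h5 : ∑ v, min (P y v) (P y' v) ≤ err y + err y' := by
      rw [herr, ← Finset.sum_add_distrib]
      refine Finset.sum_le_sum fun v _ => ?_
      by_cases h : f v = y
      · have h' : f v ≠ y' := fun h' => hy (h.symm.trans h')
        simp only [h', ne_eq, not_false_eq_true, if_true, mul_one]
        exact (min_le_right _ _).trans (le_add_of_nonneg_left
          (mul_nonneg (hP0 _ _) (by split_ifs <;> norm_num)))
      · simp only [h, ne_eq, not_false_eq_true, if_true, mul_one]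
        exact (min_le_left _ _).trans (le_add_of_nonneg_right
          (mul_nonneg (hP0 _ _) (by split_ifs <;> norm_num)))
    rw [hα, h3]; linarith
  -- Each label is paired with its cyclic successor; every error is then counted twice, so the mean
  -- error is at least `α / 2`.
  have hshift : ∑ y : Fin k, err (y + 1) = ∑ y, err y := Equiv.sum_comp (Equiv.addRight (1 : Fin k)) err
  have hne : ∀ y : Fin k, y ≠ y + 1 := fun y h => by
    have h1 : (1 : Fin k) = 0 := by simpa using h.symm
    have h2 := congrArg Fin.val h1
    rw [Fin.val_one', Nat.mod_eq_of_lt hk] at h2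
    simp at h2
  have htot : k * α ≤ 2 * ∑ y, err y := by
    calc k * α = ∑ _y : Fin k, α := by simp
      _ ≤ ∑ y, (err y + err (y + 1)) := Finset.sum_le_sum fun y _ => hpair y _ (hne y)
      _ = _ := by rw [Finset.sum_add_distrib, hshift]; ring
  have hgoal : ∑ y, ∑ v : Fin n → Fin k, voteWeight k n g y v * (if f v ≠ y then 1 else 0) =
      1 / k * ∑ y, err y := by
    rw [Finset.mul_sum]
    refine Finset.sum_congr rfl fun y _ => ?_
    rw [herr, Finset.mul_sum]
    exact Finset.sum_congr rfl fun v _ => by rw [voteWeight, mul_assoc]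
  have hkpos : (0 : ℝ) < k := lt_of_le_of_ne (Nat.cast_nonneg k) (Ne.symm hk0)
  rw [hgoal, mul_comm (1 / (k : ℝ)), mul_one_div, le_div_iff₀ hkpos]
  rw [hα] at htot
  linarith

end LabelDistributions

/-! ### Conditioning on the past under an infinite product measure. -/

section ProductMeasures

open scoped ENNReal

variable {Z : Type*} [MeasurableSpace Z] (μ : ℕ → Measure Z) [∀ t, IsProbabilityMeasure (μ t)]

/-- The first `t` coordinates and coordinate `t` are independent, so the latter can be integrated
out with the past held fixed. -/
lemma lintegral_infinitePi_nat_eq (t : ℕ) {G : (Fin t → Z) × Z → ℝ≥0∞} (hG : Measurable G) :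
    ∫⁻ z, G (fun s => z s, z t) ∂Measure.infinitePi μ =
      ∫⁻ z, ∫⁻ u, G (fun s => z s, u) ∂μ t ∂Measure.infinitePi μ := by
  have hind := ProbabilityTheory.iIndepFun_infinitePi (P := μ) (X := fun _ z => z)
    fun _ => measurable_id
  have h1 := hind.indepFun_finset (Finset.range t) {t} (by simp) fun i => by fun_prop
  have hψ : Measurable fun h : ({t} : Finset ℕ) → Z => h ⟨t, Finset.mem_singleton_self t⟩ :=
    measurable_pi_apply _
  have h2 := h1.comp (φ := fun h (s : Fin t) => h ⟨s, Finset.mem_range.2 s.isLt⟩)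
    (by fun_prop) hψ
  have h3 : ProbabilityTheory.IndepFun (fun z : ℕ → Z => fun s : Fin t => z s) (fun z => z t)
      (Measure.infinitePi μ) := h2
  have hpre : Measurable fun (z : ℕ → Z) (s : Fin t) => z s := by fun_prop
  have h4 := (ProbabilityTheory.indepFun_iff_map_prod_eq_prod_map_map
    hpre.aemeasurable (measurable_pi_apply t).aemeasurable).1 h3
  rw [Measure.infinitePi_map_eval] at h4
  have hm : Measurable fun z : ℕ → Z => ((fun s : Fin t => z s), z t) := by fun_prop
  have : IsProbabilityMeasure ((Measure.infinitePi μ).map fun z (s : Fin t) => z s) :=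
    Measure.isProbabilityMeasure_map hpre.aemeasurable
  rw [← lintegral_map (f := G) hG hm, h4, lintegral_prod _ hG.aemeasurable,
    lintegral_map hG.lintegral_prod_right' (by fun_prop)]

/-- The supermartingale argument: the last factor is integrated out given the past, which may
influence it arbitrarily, and the rest follows by induction. -/
lemma lintegral_prod_range_le {F : (t : ℕ) → (Fin t → Z) → Z → ℝ≥0∞}
    (hF : ∀ t, Measurable fun p : (Fin t → Z) × Z => F t p.1 p.2) {c : ℕ → ℝ≥0∞}
    (hc : ∀ t h, ∫⁻ u, F t h u ∂μ t ≤ c t) (T : ℕ) :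
    ∫⁻ z, ∏ t ∈ Finset.range T, F t (fun s => z s) (z t) ∂Measure.infinitePi μ ≤
      ∏ t ∈ Finset.range T, c t := by
  induction T with
  | zero => simp
  | succ T ih =>
    simp only [Finset.prod_range_succ]
    set H : (Fin T → Z) → ℝ≥0∞ := fun h => ∏ t : Fin T,
      F t (fun s => h ⟨s, s.isLt.trans t.isLt⟩) (h t) with hH
    have hHm : Measurable H := by
      refine Finset.measurable_prod _ fun t _ => ?_
      exact (hF t).comp (g := fun p : (Fin t → Z) × Z => F t p.1 p.2)
        (f := fun h : Fin T → Z => (fun s : Fin t => h ⟨s, s.isLt.trans t.isLt⟩, h t))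
        (by fun_prop)
    have hz : ∀ z : ℕ → Z, ∏ t ∈ Finset.range T, F t (fun s => z s) (z t) =
        H fun s => z s := fun z => Finset.prod_range _
    simp only [hz] at ih ⊢
    rw [lintegral_infinitePi_nat_eq μ T (G := fun p => H p.1 * F T p.1 p.2)
      ((hHm.comp measurable_fst).mul (hF T))]
    calc _ ≤ ∫⁻ z, H (fun s => z s) * c T ∂Measure.infinitePi μ := by
          refine lintegral_mono fun z => ?_
          have hFm : Measurable fun u => F T (fun s => z s) u :=
            (hF T).comp (measurable_const.prodMk measurable_id)
          simp only [lintegral_const_mul _ hFm]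
          gcongr
          exact hc T _
      _ = (∫⁻ z, H (fun s => z s) ∂Measure.infinitePi μ) * c T :=
          lintegral_mul_const _ (hHm.comp (g := H) (f := fun (z : ℕ → Z) (s : Fin T) => z s) (by fun_prop))
      _ ≤ _ := by gcongr

end ProductMeasures

/-! ### The law of one round. -/

section LabelLaws

open scoped ENNReal

variable {k : ℕ}

/-- The law of a prediction with edge `g` when the correct label is `y`. -/
noncomputable def labelLaw (k : ℕ) (g : unitInterval) (y : Fin k) : Measure (Fin k) :=
  ∑ r, ENNReal.ofReal (biasedUniform k g y r) • Measure.dirac r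

lemma labelLaw_singleton (g : unitInterval) (y r : Fin k) :
    labelLaw k g y {r} = ENNReal.ofReal (biasedUniform k g y r) := by
  simp [labelLaw, Set.indicator_apply]

instance [NeZero k] (g : unitInterval) (y : Fin k) : IsProbabilityMeasure (labelLaw k g y) where
  measure_univ := by
    simp only [labelLaw, Measure.coe_finsetSum, Measure.coe_smul, Finset.sum_apply, Pi.smul_apply,
      measure_univ, smul_eq_mul, mul_one]
    rw [← ENNReal.ofReal_sum_of_nonneg fun r _ => biasedUniform_nonneg g.2.1 g.2.2 y r,
      sum_biasedUniform, ENNReal.ofReal_one]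

/-- The correct label together with the votes of all learners. -/
abbrev RoundLabels (k : ℕ) : Type := Fin k × (ℕ → Fin k)

/-- The label is uniform, and given the label the votes are independent and have edge `g`. -/
noncomputable def roundLaw (k : ℕ) (g : unitInterval) : Measure (RoundLabels k) :=
  ∑ y, ENNReal.ofReal (1 / k) •
    (Measure.dirac y).prod (Measure.infinitePi fun _ : ℕ => labelLaw k g y)

instance [NeZero k] (g : unitInterval) : IsProbabilityMeasure (roundLaw k g) where
  measure_univ := by
    have hk : (k : ℝ) ≠ 0 := Nat.cast_ne_zero.2 (NeZero.ne k)
    simp only [roundLaw, Measure.coe_finsetSum, Measure.coe_smul, Finset.sum_apply, Pi.smul_apply,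
      measure_univ, smul_eq_mul, mul_one]
    rw [← ENNReal.ofReal_sum_of_nonneg fun r _ => by positivity]
    simp [hk]

lemma lintegral_infinitePi_labelLaw [NeZero k] (g : unitInterval) (y : Fin k) (n : ℕ)
    (f : (Fin n → Fin k) → ℝ≥0∞) :
    ∫⁻ l, f (fun i => l i) ∂Measure.infinitePi (fun _ : ℕ => labelLaw k g y) =
      ∑ v, ENNReal.ofReal (∏ i, biasedUniform k g y (v i)) * f v := by
  have hmap := Measure.map_infinitePi_infinitePi_of_inj (P := fun _ : ℕ => labelLaw k g y)
    (f := fun i : Fin n => (i : ℕ)) Fin.val_injective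
  have hm : Measurable fun (l : ℕ → Fin k) (i : Fin n) => l i := by fun_prop
  rw [← lintegral_map (f := f) Measurable.of_discrete hm, hmap, lintegral_fintype]
  refine Finset.sum_congr rfl fun v _ => ?_
  rw [Measure.infinitePi_singleton_of_fintype, mul_comm,
    ENNReal.ofReal_prod_of_nonneg fun i _ => biasedUniform_nonneg g.2.1 g.2.2 y _]
  simp only [labelLaw_singleton]

/-- Bridge from measures to the finite sums above: a quantity that depends on `n` votes only sees
their joint weight `voteWeight`. -/
lemma lintegral_roundLaw [NeZero k] (g : unitInterval) (n : ℕ)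
    (f : Fin k → (Fin n → Fin k) → ℝ) (hf : ∀ y v, 0 ≤ f y v) :
    ∫⁻ u, ENNReal.ofReal (f u.1 fun i => u.2 i) ∂roundLaw k g =
      ENNReal.ofReal (∑ y, ∑ v, voteWeight k n g y v * f y v) := by
  have hm : Measurable fun u : RoundLabels k => ENNReal.ofReal (f u.1 fun i => u.2 i) :=
    (Measurable.of_discrete (f := fun p : Fin k × (Fin n → Fin k) =>
      ENNReal.ofReal (f p.1 p.2))).comp
        (f := fun u : RoundLabels k => (u.1, fun i : Fin n => u.2 i)) (by fun_prop)
  have hg := g.2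
  have hv : ∀ y (v : Fin n → Fin k), 0 ≤ voteWeight k n g y v * f y v := fun y v =>
    mul_nonneg (voteWeight_nonneg hg.1 hg.2 y v) (hf y v)
  rw [roundLaw, lintegral_finsetSum_measure,
    ENNReal.ofReal_sum_of_nonneg fun y _ => Finset.sum_nonneg fun v _ => hv y v]
  refine Finset.sum_congr rfl fun y _ => ?_
  rw [lintegral_smul_measure, lintegral_prod _ hm.aemeasurable, lintegral_dirac,
    lintegral_infinitePi_labelLaw g y n (fun v => ENNReal.ofReal (f y v)), smul_eq_mul,
    Finset.mul_sum, ENNReal.ofReal_sum_of_nonneg fun v _ => hv y v]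
  refine Finset.sum_congr rfl fun v _ => ?_
  have hp : 0 ≤ ∏ i, biasedUniform k g y (v i) :=
    Finset.prod_nonneg fun i _ => biasedUniform_nonneg hg.1 hg.2 y _
  rw [← ENNReal.ofReal_mul hp, ← ENNReal.ofReal_mul (by positivity), voteWeight, mul_assoc]

end LabelLaws

/-! ### Unfolding the game. -/

section Game

variable {k : ℕ}

lemma sequentialVotes_const {N : ℕ} (v : Fin N → Fin k) :
    sequentialVotes (fun i _ => v i) = v := by
  funext i
  rw [sequentialVotes]

lemma history_eq_round (E : Environment k) {N : ℕ} (B : Booster E.X k N) (ω : E.Sample B) (t : ℕ)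
    (s : Fin t) : E.history B ω t s = E.round B ω s := by
  induction t with
  | zero => exact s.elim0
  | succ t ih =>
    refine Fin.lastCases ?_ (fun s => ?_) s
    · simp [Environment.history, Environment.round]
    · simp [Environment.history, ih]

end Game

/-! ### The one-time-pad environment. -/

section MaskedEnvironment

open scoped ENNReal

variable {k : ℕ} [NeZero k]

/-- The uniform distribution on the labels. -/
noncomputable abbrev uniformLabel (k : ℕ) [NeZero k] : Measure (Fin k) := labelLaw k 0 0

lemma measurePreserving_sub_uniformLabel (v : Fin k) :
    MeasurePreserving (fun r => v - r) (uniformLabel k) (uniformLabel k) := by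
  refine ⟨Measurable.of_discrete, Measure.ext_of_singleton fun s => ?_⟩
  have h : (fun r => v - r) ⁻¹' {s} = {v - s} := by
    ext r
    simp only [Set.mem_preimage, Set.mem_singleton_iff]
    rw [sub_eq_iff_eq_add, eq_sub_iff_add_eq, add_comm, eq_comm]
  rw [Measure.map_apply Measurable.of_discrete (measurableSet_singleton s), h,
    labelLaw_singleton, labelLaw_singleton]
  simp [biasedUniform]

/-- The `i`-th learner adds, in round `t`, its `t`-th secret label to the `i`-th coordinate of the
example. -/
noncomputable abbrev maskedLearner (k : ℕ) [NeZero k] (i : ℕ) : WeakLearner (ℕ → Fin k) k where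
  Coin := ℕ → Fin k
  law := Measure.infinitePi fun _ => uniformLabel k
  predict t r _ x _ := x i + r t
  measurable_predict t := by fun_prop

/-- The adversary draws the labels and the votes by `law` and lets the examples encode the votes by
one-time pads, the keys of which are the secrets of the learners. -/
noncomputable abbrev maskedAdversary (law : Measure (ℕ → RoundLabels k))
    [IsProbabilityMeasure law] : Adversary (ℕ → Fin k) k (ℕ → ℕ → Fin k) where
  Coin := ℕ → RoundLabels k
  law := law
  draw t z r _ := (fun i => (z t).2 i - r i t, (z t).1)
  measurable_draw t := by fun_prop

/-- The environment in which the labels and votes have the law `law`, and the examples are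
independent of them. -/
noncomputable abbrev maskedEnvironment (law : Measure (ℕ → RoundLabels k))
    [IsProbabilityMeasure law] : Environment k where
  X := ℕ → Fin k
  learner := maskedLearner k
  adversary := maskedAdversary law

/-- The coordinates of the examples, when the votes are `z` and the secrets are `r`. -/
def masked (z : ℕ → RoundLabels k) (r : ℕ → ℕ → Fin k) : ℕ → ℕ → Fin k :=
  fun i t => (z t).2 i - r i t

/-- Perfect secrecy: each key is uniform on the cyclic group `Fin k`, and reflecting and translating
it coordinatewise leaves it uniform. -/
lemma measurePreserving_masked (z : ℕ → RoundLabels k) :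
    MeasurePreserving (masked z)
      (Measure.infinitePi fun _ : ℕ => Measure.infinitePi fun _ : ℕ => uniformLabel k)
      (Measure.infinitePi fun _ : ℕ => Measure.infinitePi fun _ : ℕ => uniformLabel k) := by
  have h1 : ∀ i : ℕ, Measurable fun (r : ℕ → Fin k) t => (z t).2 i - r t := fun i => by fun_prop
  refine ⟨by unfold masked; fun_prop, ?_⟩
  have h2 := Measure.infinitePi_map_pi
    (fun _ : ℕ => Measure.infinitePi fun _ : ℕ => uniformLabel k)
    (f := fun i r t => (z t).2 i - r t) h1
  refine Eq.trans h2 ?_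
  congr 1
  funext i
  rw [Measure.infinitePi_map_pi (fun _ : ℕ => uniformLabel k)
    (f := fun t r => (z t).2 i - r) fun t => Measurable.of_discrete]
  congr 1
  funext t
  exact (measurePreserving_sub_uniformLabel _).map_eq

/-- What the booster has seen of the rounds before `t`. -/
def pastView (N : ℕ) (ξ : ℕ → ℕ → Fin k) {t : ℕ} (h : Fin t → RoundLabels k) :
    Fin t → (ℕ → Fin k) × Fin k × (Fin N → Fin k) :=
  fun s => (fun j => ξ j s, (h s).1, fun j => (h s).2 j)

variable (law : Measure (ℕ → RoundLabels k)) [IsProbabilityMeasure law] {N : ℕ}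
  (B : Booster (ℕ → Fin k) k N)

/-- Decryption cancels the key, so the votes are those drawn by the adversary whatever the booster
does. The secrets then enter the round only through `masked`. -/
lemma round_maskedEnvironment (ω : (maskedEnvironment law).Sample B) (t : ℕ) :
    (maskedEnvironment law).round B ω t =
      { x := fun j => masked ω.1 ω.2.1 j t
        y := (ω.1 t).1
        cost := fun i => B.cost t ω.2.2 (pastView N (masked ω.1 ω.2.1) fun s : Fin t => ω.1 s)
          (fun j => masked ω.1 ω.2.1 j t) i fun j => (ω.1 t).2 j
        weight := fun i => B.weight t ω.2.2 (pastView N (masked ω.1 ω.2.1) fun s : Fin t => ω.1 s)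
          (fun j => masked ω.1 ω.2.1 j t) i (fun j => (ω.1 t).2 j) (ω.1 t).1
        vote := fun i => (ω.1 t).2 i
        final := B.final t ω.2.2 (pastView N (masked ω.1 ω.2.1) fun s : Fin t => ω.1 s)
          (fun j => masked ω.1 ω.2.1 j t) fun i => (ω.1 t).2 i } := by
  have hvote : ∀ (s : ℕ) h, ((maskedEnvironment law).playRound B ω s h).vote =
      fun i : Fin N => (ω.1 s).2 i := by
    intro s h
    refine (sequentialVotes_const _).trans ?_
    funext i
    exact sub_add_cancel _ _
  have hpast : (fun s : Fin t => (((maskedEnvironment law).history B ω t s).x,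
      ((maskedEnvironment law).history B ω t s).y,
      ((maskedEnvironment law).history B ω t s).vote)) =
      pastView N (masked ω.1 ω.2.1) fun s : Fin t => ω.1 s := by
    funext s
    rw [history_eq_round]
    exact congrArg₂ Prod.mk rfl (congrArg₂ Prod.mk rfl (hvote _ _))
  have hv := hvote t ((maskedEnvironment law).history B ω t)
  unfold Environment.round
  -- The votes are kept folded as a projection of `playRound`, so that `hpast` and `hv` can rewrite
  -- them.
  have hstruct : (maskedEnvironment law).playRound B ω t ((maskedEnvironment law).history B ω t) =
      { x := fun j => masked ω.1 ω.2.1 j t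
        y := (ω.1 t).1
        cost := fun i => B.cost t ω.2.2
          (fun s : Fin t => (((maskedEnvironment law).history B ω t s).x,
            ((maskedEnvironment law).history B ω t s).y,
            ((maskedEnvironment law).history B ω t s).vote))
          (fun j => masked ω.1 ω.2.1 j t) i (before ((maskedEnvironment law).playRound B ω t
            ((maskedEnvironment law).history B ω t)).vote i)
        weight := fun i => B.weight t ω.2.2
          (fun s : Fin t => (((maskedEnvironment law).history B ω t s).x,
            ((maskedEnvironment law).history B ω t s).y,
            ((maskedEnvironment law).history B ω t s).vote))
          (fun j => masked ω.1 ω.2.1 j t) i (before ((maskedEnvironment law).playRound B ω t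
            ((maskedEnvironment law).history B ω t)).vote i) (ω.1 t).1
        vote := ((maskedEnvironment law).playRound B ω t
            ((maskedEnvironment law).history B ω t)).vote
        final := B.final t ω.2.2
          (fun s : Fin t => (((maskedEnvironment law).history B ω t s).x,
            ((maskedEnvironment law).history B ω t s).y,
            ((maskedEnvironment law).history B ω t s).vote))
          (fun j => masked ω.1 ω.2.1 j t) ((maskedEnvironment law).playRound B ω t
            ((maskedEnvironment law).history B ω t)).vote } := rfl
  rw [hstruct, hpast, hv]
  rfl

/-- Bounds that hold for all examples and all coins of the booster transfer to the game. -/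
lemma lintegral_prob_le {G : (ℕ → RoundLabels k) → (ℕ → ℕ → Fin k) → B.Coin → ℝ≥0∞}
    (hG : Measurable fun p : (ℕ → RoundLabels k) × (ℕ → ℕ → Fin k) × B.Coin =>
      G p.1 p.2.1 p.2.2) {c : ℝ≥0∞} (hc : ∀ ξ β, ∫⁻ z, G z ξ β ∂law ≤ c) :
    ∫⁻ ω, G ω.1 (masked ω.1 ω.2.1) ω.2.2 ∂(maskedEnvironment law).prob B ≤ c := by
  set ρ : Measure (ℕ → ℕ → Fin k) :=
    Measure.infinitePi fun _ : ℕ => Measure.infinitePi fun _ : ℕ => uniformLabel k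
  have hprob : (maskedEnvironment law).prob B = law.prod (ρ.prod B.law) := rfl
  have hm : Measurable fun p : (ℕ → RoundLabels k) × (ℕ → ℕ → Fin k) × B.Coin =>
      (p.1, masked p.1 p.2.1, p.2.2) := by
    unfold masked; fun_prop
  rw [hprob]
  refine (lintegral_prod _ (hG.comp hm).aemeasurable).trans_le ?_
  -- For each fixed `z` the ciphertext may be replaced by fresh uniform noise that does not involve
  -- `z`.
  have hin : ∀ z, ∫⁻ q : (ℕ → ℕ → Fin k) × B.Coin, G z (masked z q.1) q.2 ∂ρ.prod B.law =
      ∫⁻ q, G z q.1 q.2 ∂ρ.prod B.law := fun z =>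
    ((measurePreserving_masked z).prod (MeasurePreserving.id B.law)).lintegral_comp
      (f := fun q => G z q.1 q.2) (hG.comp measurable_prodMk_left)
  simp only [Function.comp_def, hin]
  rw [lintegral_lintegral_swap hG.aemeasurable]
  calc _ ≤ ∫⁻ _, c ∂ρ.prod B.law := lintegral_mono fun q => hc q.1 q.2
    _ = c := by simp

end MaskedEnvironment

/-! ### One-round bounds given the past, and their accumulation over rounds. -/

section Rounds

open scoped ENNReal

variable {k N : ℕ} (B : Booster (ℕ → Fin k) k N) (ξ : ℕ → ℕ → Fin k) (β : B.Coin)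

/-- The final prediction of the booster in round `t`. -/
def finalAt (t : ℕ) (h : Fin t → RoundLabels k) (u : RoundLabels k) : Fin k :=
  B.final t β (pastView N ξ h) (fun j => ξ j t) fun i => u.2 i

/-- The number of mistakes in round `t`. -/
def errorAt (t : ℕ) (h : Fin t → RoundLabels k) (u : RoundLabels k) : ℝ :=
  if finalAt B ξ β t h u ≠ u.1 then 1 else 0

/-- The weighted cost of the `i`-th learner in round `t` in excess of `c`. -/
def excessAt (c : ℝ) (i : Fin N) (t : ℕ) (h : Fin t → RoundLabels k) (u : RoundLabels k) : ℝ :=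
  B.weight t β (pastView N ξ h) (fun j => ξ j t) i (fun j => u.2 j) u.1 *
      B.cost t β (pastView N ξ h) (fun j => ξ j t) i (fun j => u.2 j) u.1 (u.2 i) -
    B.weight t β (pastView N ξ h) (fun j => ξ j t) i (fun j => u.2 j) u.1 * c

/-- The sum of the values of `f` over the first `T` rounds. -/
def sumRounds (f : (t : ℕ) → (Fin t → RoundLabels k) → RoundLabels k → ℝ)
    (z : ℕ → RoundLabels k) (T : ℕ) : ℝ :=
  ∑ t ∈ Finset.range T, f t (fun s => z s) (z t)

lemma errorAt_nonneg (t : ℕ) (h : Fin t → RoundLabels k) (u : RoundLabels k) :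
    0 ≤ errorAt B ξ β t h u := by unfold errorAt; split_ifs <;> norm_num

lemma errorAt_le_one (t : ℕ) (h : Fin t → RoundLabels k) (u : RoundLabels k) :
    errorAt B ξ β t h u ≤ 1 := by unfold errorAt; split_ifs <;> norm_num

lemma measurable_errorAt (t : ℕ) :
    Measurable fun p : ((Fin t → RoundLabels k) × RoundLabels k) × (ℕ → ℕ → Fin k) × B.Coin =>
      errorAt B p.2.1 p.2.2 t p.1.1 p.1.2 := by
  have h1 : Measurable fun p : ((Fin t → RoundLabels k) × RoundLabels k) ×
      (ℕ → ℕ → Fin k) × B.Coin =>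
      (p.2.2, pastView N p.2.1 p.1.1, (fun j => p.2.1 j t), fun i : Fin N => p.1.2.2 i) := by
    unfold pastView; fun_prop
  have h2 := (B.measurable_final t).comp h1
  have h3 : Measurable fun q : Fin k × Fin k => if q.1 ≠ q.2 then (1 : ℝ) else 0 :=
    Measurable.of_discrete
  exact h3.comp (h2.prodMk (measurable_fst.comp (measurable_snd.comp measurable_fst)))

lemma measurable_excessAt (c : ℝ) (i : Fin N) (t : ℕ) :
    Measurable fun p : ((Fin t → RoundLabels k) × RoundLabels k) × (ℕ → ℕ → Fin k) × B.Coin =>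
      excessAt B p.2.1 p.2.2 c i t p.1.1 p.1.2 := by
  have h1 : Measurable fun p : ((Fin t → RoundLabels k) × RoundLabels k) ×
      (ℕ → ℕ → Fin k) × B.Coin =>
      (p.2.2, pastView N p.2.1 p.1.1, (fun j => p.2.1 j t), fun j : Fin i => p.1.2.2 j) := by
    unfold pastView; fun_prop
  have h2 : Measurable fun p : ((Fin t → RoundLabels k) × RoundLabels k) ×
      (ℕ → ℕ → Fin k) × B.Coin =>
      (p.2.2, pastView N p.2.1 p.1.1, (fun j => p.2.1 j t), (fun j : Fin i => p.1.2.2 j),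
        p.1.2.1) := by
    unfold pastView; fun_prop
  have hw := (B.measurable_weight t i).comp h2
  have hC := (B.measurable_cost t i).comp h1
  have hy : Measurable fun p : ((Fin t → RoundLabels k) × RoundLabels k) ×
      (ℕ → ℕ → Fin k) × B.Coin => (p.1.2.1, p.1.2.2 i) := by fun_prop
  have hev : Measurable fun q : CostMatrix k × Fin k × Fin k => q.1 q.2.1 q.2.2 :=
    measurable_from_prod_countable_left fun y =>
      (measurable_pi_apply y.2).comp (measurable_pi_apply y.1)
  exact (hw.mul (hev.comp (hC.prodMk hy))).sub (hw.mul_const c)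

lemma measurable_sumRounds
    {f : (ℕ → ℕ → Fin k) → B.Coin → (t : ℕ) → (Fin t → RoundLabels k) → RoundLabels k → ℝ}
    (hf : ∀ t, Measurable fun p : ((Fin t → RoundLabels k) × RoundLabels k) ×
      (ℕ → ℕ → Fin k) × B.Coin => f p.2.1 p.2.2 t p.1.1 p.1.2) (T : ℕ) :
    Measurable fun p : (ℕ → RoundLabels k) × (ℕ → ℕ → Fin k) × B.Coin =>
      sumRounds (f p.2.1 p.2.2) p.1 T := by
  refine Finset.measurable_sum _ fun t _ => ?_
  have h1 : Measurable fun p : (ℕ → RoundLabels k) × (ℕ → ℕ → Fin k) × B.Coin =>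
      (((fun s : Fin t => p.1 s), p.1 t), p.2) := by fun_prop
  exact (hf t).comp h1

variable [NeZero k]

/-- The chance of exceeding a threshold decays exponentially, if in every round, given the
preceding ones, the exponential moment is bounded. -/
lemma infinitePi_sumRounds_ge_le (g : ℕ → unitInterval)
    {f : (t : ℕ) → (Fin t → RoundLabels k) → RoundLabels k → ℝ}
    (hf : ∀ t, Measurable fun p : (Fin t → RoundLabels k) × RoundLabels k => f t p.1 p.2)
    {b : ℕ → ℝ} (hb : ∀ t h, ∫⁻ u, ENNReal.ofReal (Real.exp (f t h u)) ∂roundLaw k (g t) ≤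
      ENNReal.ofReal (Real.exp (b t))) (T : ℕ) (a : ℝ) :
    Measure.infinitePi (fun t => roundLaw k (g t)) {z | a ≤ sumRounds f z T} ≤
      ENNReal.ofReal (Real.exp (∑ t ∈ Finset.range T, b t - a)) := by
  have hF : ∀ t, Measurable fun p : (Fin t → RoundLabels k) × RoundLabels k =>
      ENNReal.ofReal (Real.exp (f t p.1 p.2)) := fun t => (hf t).exp.ennreal_ofReal
  have h1 := lintegral_prod_range_le (fun t => roundLaw k (g t))
    (F := fun t h u => ENNReal.ofReal (Real.exp (f t h u))) hF hb T
  simp only [← ENNReal.ofReal_prod_of_nonneg fun _ _ => (Real.exp_nonneg _),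
    ← Real.exp_sum] at h1
  have hm : Measurable fun z : ℕ → RoundLabels k =>
      ENNReal.ofReal (Real.exp (∑ t ∈ Finset.range T, f t (fun s => z s) (z t))) := by
    refine (Finset.measurable_sum _ fun t _ => ?_).exp.ennreal_ofReal
    have h2 : Measurable fun z : ℕ → RoundLabels k => ((fun s : Fin t => z s), z t) := by fun_prop
    exact (hf t).comp h2
  have h3 := mul_meas_ge_le_lintegral (μ := Measure.infinitePi fun t => roundLaw k (g t)) hm
    (ENNReal.ofReal (Real.exp a))
  have hset : {z : ℕ → RoundLabels k | a ≤ sumRounds f z T} ⊆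
      {z | ENNReal.ofReal (Real.exp a) ≤
        ENNReal.ofReal (Real.exp (∑ t ∈ Finset.range T, f t (fun s => z s) (z t)))} := fun z hz =>
    ENNReal.ofReal_le_ofReal (Real.exp_le_exp.2 hz)
  refine (measure_mono hset).trans ?_
  rw [Real.exp_sub, ENNReal.ofReal_div_of_pos (Real.exp_pos a)]
  rw [ENNReal.le_div_iff_mul_le (Or.inl (by simpa using Real.exp_pos a))
    (Or.inl ENNReal.ofReal_ne_top), mul_comm]
  exact h3.trans h1

lemma lintegral_exp_excessAt_le (g : unitInterval) {lam b c : ℝ} (hl : 0 ≤ lam) (hl1 : lam ≤ 1)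
    (hb : ∀ u ∈ Set.Icc (0 : ℝ) 1,
      (lam + lam ^ 2) * u * ((1 - g) / k) - lam * (u * c) ≤ b)
    (i : Fin N) (t : ℕ) (h : Fin t → RoundLabels k) :
    ∫⁻ u, ENNReal.ofReal (Real.exp (lam * excessAt B ξ β c i t h u)) ∂roundLaw k g ≤
      ENNReal.ofReal (Real.exp b) := by
  -- The choices for learner `i` depend only on the label and on the votes before `i`; its own vote
  -- is the last of `i + 1`.
  have h1 := lintegral_roundLaw g (i + 1) (fun y v => Real.exp (lam *
    (B.weight t β (pastView N ξ h) (fun j => ξ j t) i (Fin.init v) y *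
      B.cost t β (pastView N ξ h) (fun j => ξ j t) i (Fin.init v) y (v (Fin.last i)) -
    B.weight t β (pastView N ξ h) (fun j => ξ j t) i (Fin.init v) y * c)))
    fun y v => Real.exp_nonneg _
  refine h1.trans_le (ENNReal.ofReal_le_ofReal ?_)
  exact sum_voteWeight_mul_exp_cost_le i g.2.1 g.2.2 hl hl1
    (fun p => B.cost t β (pastView N ξ h) (fun j => ξ j t) i p)
    (fun p y => B.weight t β (pastView N ξ h) (fun j => ξ j t) i p y)
    (fun p => B.cost_admissible _ _ _ _ _ _) (fun p y => B.weight_mem _ _ _ _ _ _ _) c b hb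

lemma lintegral_exp_neg_errorAt_le (hk : 2 ≤ k) (g : unitInterval) {p : ℝ}
    (hg : (g : ℝ) ≤ 3 / 4) (hp : p ≤ 1 / 4 * Real.exp (-(8 * N * k * (g : ℝ) ^ 2))) (t : ℕ)
    (h : Fin t → RoundLabels k) :
    ∫⁻ u, ENNReal.ofReal (Real.exp (-errorAt B ξ β t h u)) ∂roundLaw k g ≤
      ENNReal.ofReal (Real.exp (-(3 / 5 * p))) := by
  set f : (Fin N → Fin k) → Fin k := fun v => B.final t β (pastView N ξ h) (fun j => ξ j t) v
  have h1 := lintegral_roundLaw g N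
    (fun y v => Real.exp (-(if f v ≠ y then (1 : ℝ) else 0))) fun y v => Real.exp_nonneg _
  refine h1.trans_le (ENNReal.ofReal_le_ofReal ?_)
  have herr := hp.trans (le_sum_voteWeight_error hk N g.2.1 hg f)
  have hexp : ∀ y (v : Fin N → Fin k), voteWeight k N g y v *
      Real.exp (-(if f v ≠ y then (1 : ℝ) else 0)) = voteWeight k N g y v -
        (1 - Real.exp (-1)) * (voteWeight k N g y v * (if f v ≠ y then 1 else 0)) := by
    intro y v
    split_ifs
    · ring
    · simp
  simp only [hexp, Finset.sum_sub_distrib, ← Finset.mul_sum, sum_voteWeight]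
  -- This gives `1 - exp (-1) > 3 / 5`, the source of the constant in the bound.
  have he := Real.exp_neg_one_lt_d9
  set s := ∑ y, ∑ v : Fin N → Fin k, voteWeight k N g y v * (if f v ≠ y then (1 : ℝ) else 0)
  have hs : 0 ≤ s := Finset.sum_nonneg fun y _ => Finset.sum_nonneg fun v _ =>
    mul_nonneg (voteWeight_nonneg g.2.1 g.2.2 y v) (by split_ifs <;> norm_num)
  have h2 := Real.add_one_le_exp (-(3 / 5 * p))
  nlinarith

lemma lintegral_one_sub_errorAt_le (t : ℕ) (h : Fin t → RoundLabels k) :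
    ∫⁻ u, ENNReal.ofReal (1 - errorAt B ξ β t h u) ∂roundLaw k 0 ≤ ENNReal.ofReal (1 / k) := by
  set f : (Fin N → Fin k) → Fin k := fun v => B.final t β (pastView N ξ h) (fun j => ξ j t) v
  have h1 := lintegral_roundLaw (0 : unitInterval) N
    (fun y v => if f v = y then (1 : ℝ) else 0) fun y v => by split_ifs <;> norm_num
  have h2 : ∀ u : RoundLabels k, 1 - errorAt B ξ β t h u =
      if f (fun i => u.2 i) = u.1 then (1 : ℝ) else 0 := by
    intro u
    change 1 - (if f (fun i => u.2 i) ≠ u.1 then (1 : ℝ) else 0) = _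
    by_cases hu : f (fun i => u.2 i) = u.1 <;> simp [hu]
  simp only [h2]
  refine h1.trans_le (ENNReal.ofReal_le_ofReal ?_)
  exact (sum_voteWeight_zero_correct N f).le

lemma lintegral_one_sub_errorAt_le_one (g : unitInterval) (t : ℕ) (h : Fin t → RoundLabels k) :
    ∫⁻ u, ENNReal.ofReal (1 - errorAt B ξ β t h u) ∂roundLaw k g ≤ 1 := by
  calc _ ≤ ∫⁻ _, 1 ∂roundLaw k g := lintegral_mono fun u => by
        rw [ENNReal.ofReal_le_one]; linarith [errorAt_nonneg B ξ β t h u]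
    _ = 1 := by simp

/-- The expected number of correct predictions in `n` rounds. -/
lemma lintegral_sum_correct_le (g : ℕ → unitInterval) {c : ℝ} (n : ℕ)
    (h : ∀ t < n, ∀ h, ∫⁻ u, ENNReal.ofReal (1 - errorAt B ξ β t h u) ∂roundLaw k (g t) ≤
      ENNReal.ofReal c) :
    ∫⁻ z, ENNReal.ofReal (sumRounds (fun t h u => 1 - errorAt B ξ β t h u) z n)
      ∂Measure.infinitePi (fun t => roundLaw k (g t)) ≤ ENNReal.ofReal (n * c) := by
  have hm : ∀ t, Measurable fun p : (Fin t → RoundLabels k) × RoundLabels k =>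
      ENNReal.ofReal (1 - errorAt B ξ β t p.1 p.2) := fun t =>
    (((measurable_errorAt B t).comp (measurable_id.prodMk
      (measurable_const (a := (ξ, β))))).const_sub 1).ennreal_ofReal
  have h0 : ∀ t h u, 0 ≤ 1 - errorAt B ξ β t h u := fun t h u =>
    sub_nonneg.2 (errorAt_le_one B ξ β t h u)
  simp only [sumRounds, ENNReal.ofReal_sum_of_nonneg fun _ _ => h0 _ _ _]
  rw [lintegral_finsetSum]
  · calc _ ≤ ∑ t ∈ Finset.range n, ENNReal.ofReal c := by
          refine Finset.sum_le_sum fun t ht => ?_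
          rw [lintegral_infinitePi_nat_eq (fun t => roundLaw k (g t)) t
            (G := fun p => ENNReal.ofReal (1 - errorAt B ξ β t p.1 p.2)) (hm t)]
          calc _ ≤ ∫⁻ _, ENNReal.ofReal c ∂Measure.infinitePi (fun t => roundLaw k (g t)) :=
                lintegral_mono fun z => h t (Finset.mem_range.1 ht) _
            _ = ENNReal.ofReal c := by simp
      _ = _ := by
          rw [Finset.sum_const, Finset.card_range, nsmul_eq_mul, ENNReal.ofReal_mul (by positivity),
            ENNReal.ofReal_natCast]
  · intro t _
    have h2 : Measurable fun z : ℕ → RoundLabels k => ((fun s : Fin t => z s), z t) := by fun_prop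
    exact (hm t).comp h2

end Rounds

/-! ### Probability bounds valid in every environment. -/

section AnyGame

variable {k N : ℕ} (E : Environment k) (B : Booster E.X k N)

lemma isProbabilityMeasure_prob : IsProbabilityMeasure (E.prob B) := by
  unfold Environment.prob; infer_instance

/-- Subadditivity on the cover by `good` and `bad` needs no measurability of either set. -/
lemma one_sub_le_real_prob {good bad : Set (E.Sample B)} (h : ∀ ω, ω ∉ bad → ω ∈ good) {δ : ℝ}
    (hδ : 0 ≤ δ) (hbad : E.prob B bad ≤ ENNReal.ofReal δ) : 1 - δ ≤ (E.prob B).real good := by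
  have := isProbabilityMeasure_prob E B
  have hcover : good ∪ bad = Set.univ :=
    Set.eq_univ_of_forall fun ω => (em (ω ∈ bad)).elim Or.inr fun hω => Or.inl (h ω hω)
  have h1 := measureReal_union_le (μ := E.prob B) good bad
  rw [hcover, probReal_univ] at h1
  have h2 : (E.prob B).real bad ≤ δ := ENNReal.toReal_le_of_le_ofReal hδ hbad
  linarith

/-- Markov's inequality, arranged so that `A` need not be measurable. -/
lemma mul_real_le_of_lintegral_le {Ω : Type*} [MeasurableSpace Ω] (P : Measure Ω)
    [IsFiniteMeasure P] {f : Ω → ENNReal} (hf : Measurable f) {c r q : ℝ} (hc : 0 ≤ c)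
    (hr : 0 ≤ r) (hint : ∫⁻ ω, f ω ∂P ≤ ENNReal.ofReal c) {A : Set Ω} (hq : q ≤ P.real A)
    (hA : ∀ ω ∈ A, ENNReal.ofReal r ≤ f ω) : r * q ≤ c := by
  have h1 : ENNReal.ofReal q ≤ P A := by
    rw [ENNReal.ofReal_le_iff_le_toReal (measure_ne_top _ _)]
    exact hq
  have h2 : ENNReal.ofReal r * ENNReal.ofReal q ≤ ENNReal.ofReal c :=
    (mul_le_mul_right (h1.trans (measure_mono hA)) _).trans
      ((mul_meas_ge_le_lintegral hf _).trans hint)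
  rwa [← ENNReal.ofReal_mul hr, ENNReal.ofReal_le_ofReal_iff hc] at h2

lemma mistakes_le (ω : E.Sample B) (T : ℕ) :
    E.mistakes B ω T ≤ T :=
  (Finset.card_filter_le _ _).trans (Finset.card_range T).le

lemma mistakes_mono (ω : E.Sample B) :
    Monotone (E.mistakes B ω) := fun _ _ h =>
  Finset.card_le_card (Finset.filter_subset_filter _ (Finset.range_mono h))

end AnyGame

/-! ### From bounds for fixed examples and booster coins to statements about the game. -/

section MaskedGame

open scoped ENNReal

variable {k : ℕ} [NeZero k] (law : Measure (ℕ → RoundLabels k)) [IsProbabilityMeasure law]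

lemma measure_prob_le {N : ℕ} (B : Booster (ℕ → Fin k) k N)
    {A : Set ((ℕ → RoundLabels k) × (ℕ → ℕ → Fin k) × B.Coin)} (hA : MeasurableSet A) {c : ℝ≥0∞}
    (hc : ∀ ξ β, law {z | (z, ξ, β) ∈ A} ≤ c) :
    (maskedEnvironment law).prob B {ω | (ω.1, masked ω.1 ω.2.1, ω.2.2) ∈ A} ≤ c := by
  have hm : Measurable fun p : (ℕ → RoundLabels k) × (ℕ → ℕ → Fin k) × B.Coin =>
      (p.1, masked p.1 p.2.1, p.2.2) := by
    unfold masked; fun_prop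
  have h := lintegral_prob_le law B (G := fun z ξ β => A.indicator 1 (z, ξ, β))
    (measurable_one.indicator hA) (c := c) fun ξ β => by
      have hs : MeasurableSet {z | (z, ξ, β) ∈ A} := measurable_prodMk_right hA
      refine Eq.trans_le ?_ (hc ξ β)
      exact lintegral_indicator_one hs
  refine Eq.trans_le ?_ h
  exact (lintegral_indicator_one (hm hA)).symm

/-- The weak learning condition holds if it holds for every fixed sequence of examples and all
fixed coins of the booster. -/
lemma weakLearningCondition_maskedEnvironment {γ δ S : ℝ}
    (h : ∀ (N : ℕ) (B : Booster (ℕ → Fin k) k N) (ξ : ℕ → ℕ → Fin k) (β : B.Coin) (T : ℕ)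
      (i : Fin N), law {z | S < sumRounds (excessAt B ξ β ((1 - γ) / k) i) z T} ≤
        ENNReal.ofReal δ) (hδ : 0 ≤ δ) :
    (maskedEnvironment law).WeakLearningCondition δ γ S := by
  intro N B T i
  have hbad := measure_prob_le law B
    (measurableSet_lt measurable_const (measurable_sumRounds B
      (f := fun ξ β => excessAt B ξ β ((1 - γ) / k) i)
      (fun t => measurable_excessAt B ((1 - γ) / k) i t) T))
    (c := ENNReal.ofReal δ) fun ξ β => h N B ξ β T i
  refine one_sub_le_real_prob (maskedEnvironment law) B (fun ω hω => ?_) hδ hbad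
  have hω' : sumRounds (excessAt B (masked ω.1 ω.2.1) ω.2.2 ((1 - γ) / k) i) ω.1 T ≤ S :=
    not_lt.1 hω
  rw [Set.mem_ofPred_eq, ← sub_le_iff_le_add', ← Finset.sum_sub_distrib]
  refine Eq.trans_le ?_ hω'
  refine Finset.sum_congr rfl fun t _ => ?_
  rw [round_maskedEnvironment]
  simp only [mul_assoc, ← Finset.mul_sum]
  rw [sum_cost_mul_biasedUniform (B.cost_admissible _ _ _ _ _ _)]
  rfl

variable {N : ℕ} (B : Booster (ℕ → Fin k) k N)

lemma mistakes_maskedEnvironment (ω : (maskedEnvironment law).Sample B) (T : ℕ) :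
    ((maskedEnvironment law).mistakes B ω T : ℝ) =
      sumRounds (errorAt B (masked ω.1 ω.2.1) ω.2.2) ω.1 T := by
  rw [Environment.mistakes, Finset.card_filter, Nat.cast_sum, sumRounds]
  refine Finset.sum_congr rfl fun t _ => ?_
  rw [round_maskedEnvironment, Nat.cast_ite, Nat.cast_one, Nat.cast_zero]
  rfl

/-- The mistakes in the first `n` rounds are among those in `T` rounds. -/
lemma le_sum_correct_of_mistakes_le {n T : ℕ} (hn : n ≤ T) (ω : (maskedEnvironment law).Sample B)
    {m : ℝ} (hω : ((maskedEnvironment law).mistakes B ω T : ℝ) ≤ m) : n - m ≤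
      sumRounds (fun t h u => 1 - errorAt B (masked ω.1 ω.2.1) ω.2.2 t h u) ω.1 n := by
  have h1 : ((maskedEnvironment law).mistakes B ω n : ℝ) ≤ m :=
    (Nat.cast_le.2 (mistakes_mono (maskedEnvironment law) B ω hn)).trans hω
  rw [mistakes_maskedEnvironment] at h1
  unfold sumRounds at h1 ⊢
  rw [Finset.sum_sub_distrib, Finset.sum_const, Finset.card_range, nsmul_eq_mul, mul_one]
  exact sub_le_sub_left h1 _

/-- If few predictions in the first `n` rounds are correct on average, then the booster cannot have
few mistakes with high probability. -/
lemma le_of_hasErrorRateAfter {n T : ℕ} (hn : n ≤ T) {ε c : ℝ}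
    (h : ∀ ξ β, ∫⁻ z, ENNReal.ofReal (sumRounds (fun t h u => 1 - errorAt B ξ β t h u) z n) ∂law ≤
      ENNReal.ofReal c) (hc : 0 ≤ c)
    (hT : (maskedEnvironment law).HasErrorRateAfter B T ε) : 3 / 4 * (n - ε * T) ≤ c := by
  have hm : Measurable fun p : (ℕ → RoundLabels k) × (ℕ → ℕ → Fin k) × B.Coin =>
      sumRounds (fun t h u => 1 - errorAt B p.2.1 p.2.2 t h u) p.1 n :=
    measurable_sumRounds B (f := fun ξ β t h u => 1 - errorAt B ξ β t h u)
      (fun t => (measurable_errorAt B t).const_sub 1) n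
  have hmask : Measurable fun p : (ℕ → RoundLabels k) × (ℕ → ℕ → Fin k) × B.Coin =>
      (p.1, masked p.1 p.2.1, p.2.2) := by
    unfold masked; fun_prop
  have hint := lintegral_prob_le law B
    (G := fun z ξ β => ENNReal.ofReal (sumRounds (fun t h u => 1 - errorAt B ξ β t h u) z n))
    hm.ennreal_ofReal h
  rcases le_or_gt ((n : ℝ) - ε * T) 0 with h0 | h0
  · linarith
  have hP := isProbabilityMeasure_prob (maskedEnvironment law) B
  have hf := hm.ennreal_ofReal.comp hmask
  rw [mul_comm]
  exact mul_real_le_of_lintegral_le ((maskedEnvironment law).prob B) hf hc h0.le hint hT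
    fun ω hω => ENNReal.ofReal_le_ofReal
      (le_sum_correct_of_mistakes_le law B hn ω hω)

/-- If few mistakes in `T` rounds are exponentially unlikely, then the booster almost surely has a
positive asymptotic error rate. -/
lemma not_reachesAsymptoticErrorRate {a b ε : ℝ} (hb : 0 < b) (hε : ε < a)
    (h : ∀ ξ β (T : ℕ), law {z | sumRounds (errorAt B ξ β) z T ≤ a * T} ≤
      ENNReal.ofReal (Real.exp (-b * T))) :
    ¬ (maskedEnvironment law).ReachesAsymptoticErrorRate B ε := by
  set P := (maskedEnvironment law).prob B
  set A : ℕ → Set ((maskedEnvironment law).Sample B) := fun T =>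
    {ω | ((maskedEnvironment law).mistakes B ω T : ℝ) ≤ a * T}
  have hA : ∀ T, P (A T) ≤ ENNReal.ofReal (Real.exp (-b * T)) := by
    intro T
    have h1 := measure_prob_le law B
      (measurableSet_le (measurable_sumRounds B (f := fun ξ β => errorAt B ξ β)
        (fun t => measurable_errorAt B t) T) (measurable_const (a := a * T)))
      fun ξ β => h ξ β T
    simp only [A, mistakes_maskedEnvironment]
    exact h1
  have hsum : ∑' T, P (A T) ≠ ∞ := by
    have hs : Summable fun T : ℕ => Real.exp (-b * T) := by
      have : ∀ T : ℕ, Real.exp (-b * T) = Real.exp (-b) ^ T := fun T => by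
        rw [← Real.exp_nat_mul, mul_comm]
      simp only [this]
      exact summable_geometric_of_lt_one (Real.exp_nonneg _) (Real.exp_lt_one_iff.2 (by linarith))
    exact ne_top_of_le_ne_top hs.tsum_ofReal_ne_top (ENNReal.tsum_le_tsum hA)
  have hae := ae_eventually_notMem hsum
  have hnull : P {ω | Filter.liminf (fun T : ℕ =>
      ((maskedEnvironment law).mistakes B ω T : ℝ) / T) Filter.atTop ≤ ε} = 0 := by
    refine measure_mono_null ?_ hae
    intro ω hω hev
    have hlow : a ≤ Filter.liminf (fun T : ℕ =>
        ((maskedEnvironment law).mistakes B ω T : ℝ) / T) Filter.atTop := by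
      refine Filter.le_liminf_of_le ?_ ?_
      -- A lower bound on a `liminf` in `ℝ` requires coboundedness; it holds as the error rate is at
      -- most 1.
      · refine Filter.IsBoundedUnder.isCoboundedUnder_ge ⟨1, ?_⟩
        refine Filter.eventually_map.2 (Filter.Eventually.of_forall fun T => ?_)
        exact div_le_one_of_le₀ (Nat.cast_le.2 (mistakes_le (maskedEnvironment law) B ω T)) (Nat.cast_nonneg T)
      · filter_upwards [hev, Filter.eventually_gt_atTop 0] with T hT hT0
        rw [le_div_iff₀ (Nat.cast_pos.2 hT0)]
        exact (not_le.1 hT).le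
    exact absurd (hlow.trans hω) (not_le.2 hε)
  intro hreach
  have h0 : P.real {ω | Filter.liminf (fun T : ℕ =>
      ((maskedEnvironment law).mistakes B ω T : ℝ) / T) Filter.atTop ≤ ε} = 0 := by
    rw [measureReal_def, hnull, ENNReal.toReal_zero]
  exact hreach.ne' h0

end MaskedGame

/-! ### The mixture that may withhold the edge initially. -/

section Mixture

open scoped ENNReal

variable {k : ℕ} [NeZero k]

/-- With probability `1 / 3` the votes in round `t` have edge `g`, and otherwise they have no edge
in the first `τ` rounds and edge `g` from then on. -/
noncomputable def delayedLaw (k : ℕ) [NeZero k] (g : unitInterval) (τ : ℕ) :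
    Measure (ℕ → RoundLabels k) :=
  ENNReal.ofReal (1 / 3) • Measure.infinitePi (fun _ => roundLaw k g) +
    ENNReal.ofReal (2 / 3) • Measure.infinitePi (fun t => roundLaw k (if t < τ then 0 else g))

instance (g : unitInterval) (τ : ℕ) : IsProbabilityMeasure (delayedLaw k g τ) where
  measure_univ := by
    simp only [delayedLaw, Measure.coe_add, Measure.coe_smul, Pi.add_apply, Pi.smul_apply,
      measure_univ, smul_eq_mul, mul_one]
    rw [← ENNReal.ofReal_add (by norm_num) (by norm_num), ← ENNReal.ofReal_one]
    norm_num

variable {g : unitInterval} {τ : ℕ}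

lemma lintegral_delayedLaw_le {f : (ℕ → RoundLabels k) → ℝ≥0∞} {a b : ℝ} (ha : 0 ≤ a) (hb : 0 ≤ b)
    (h1 : ∫⁻ z, f z ∂Measure.infinitePi (fun _ => roundLaw k g) ≤ ENNReal.ofReal a)
    (h2 : ∫⁻ z, f z ∂Measure.infinitePi (fun t => roundLaw k (if t < τ then 0 else g)) ≤
      ENNReal.ofReal b) :
    ∫⁻ z, f z ∂delayedLaw k g τ ≤ ENNReal.ofReal (1 / 3 * a + 2 / 3 * b) := by
  rw [delayedLaw, lintegral_add_measure, lintegral_smul_measure, lintegral_smul_measure,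
    smul_eq_mul, smul_eq_mul, ENNReal.ofReal_add (by positivity) (by positivity),
    ENNReal.ofReal_mul (by norm_num), ENNReal.ofReal_mul (by norm_num)]
  gcongr

lemma delayedLaw_apply_le {A : Set (ℕ → RoundLabels k)} {a b : ℝ} (ha : 0 ≤ a) (hb : 0 ≤ b)
    (h1 : Measure.infinitePi (fun _ => roundLaw k g) A ≤ ENNReal.ofReal a)
    (h2 : Measure.infinitePi (fun t => roundLaw k (if t < τ then 0 else g)) A ≤
      ENNReal.ofReal b) :
    delayedLaw k g τ A ≤ ENNReal.ofReal (1 / 3 * a + 2 / 3 * b) := by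
  simp only [delayedLaw, Measure.coe_add, Measure.coe_smul, Pi.add_apply, Pi.smul_apply,
    smul_eq_mul]
  rw [ENNReal.ofReal_add (by positivity) (by positivity),
    ENNReal.ofReal_mul (by norm_num), ENNReal.ofReal_mul (by norm_num)]
  gcongr

variable {N : ℕ} (B : Booster (ℕ → Fin k) k N) (ξ : ℕ → ℕ → Fin k) (β : B.Coin)

lemma infinitePi_excess_gt_le (g : ℕ → unitInterval) {lam c : ℝ} (hl : 0 ≤ lam) (hl1 : lam ≤ 1)
    {b : ℕ → ℝ} (hb : ∀ t, ∀ u ∈ Set.Icc (0 : ℝ) 1,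
      (lam + lam ^ 2) * u * ((1 - g t) / k) - lam * (u * c) ≤ b t) (i : Fin N) (T : ℕ) (S : ℝ) :
    Measure.infinitePi (fun t => roundLaw k (g t)) {z | S < sumRounds (excessAt B ξ β c i) z T} ≤
      ENNReal.ofReal (Real.exp (∑ t ∈ Finset.range T, b t - lam * S)) := by
  have h1 := infinitePi_sumRounds_ge_le g
    (f := fun t h u => lam * excessAt B ξ β c i t h u)
    (fun t => ((measurable_excessAt B c i t).comp (measurable_id.prodMk
      (measurable_const (a := (ξ, β))))).const_mul lam)
    (fun t h => lintegral_exp_excessAt_le B ξ β (g t) hl hl1 (hb t) i t h) T (lam * S)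
  refine (measure_mono fun z hz => ?_).trans h1
  have hz' : S ≤ sumRounds (excessAt B ξ β c i) z T := le_of_lt hz
  change lam * S ≤ ∑ t ∈ Finset.range T, lam * excessAt B ξ β c i t (fun s => z s) (z t)
  rw [← Finset.mul_sum]
  exact mul_le_mul_of_nonneg_left hz' hl

lemma delayedLaw_excess_gt_le {γ : ℝ} (hγ : 0 < γ) (hγ4 : γ < 1 / 4) (hg : (g : ℝ) = 3 * γ)
    (i : Fin N) (T : ℕ) (S : ℝ) :
    delayedLaw k g τ {z | S < sumRounds (excessAt B ξ β ((1 - γ) / k) i) z T} ≤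
      ENNReal.ofReal (1 / 3 * Real.exp (-(2 * γ * S)) +
        2 / 3 * min 1 (Real.exp (τ * (6 * γ ^ 2 / k) - 2 * γ * S))) := by
  have hk : (0 : ℝ) < k := Nat.cast_pos.2 (Nat.pos_of_ne_zero (NeZero.ne k))
  -- With `lam = 2γ` and edge `3γ`, the factor `(1 + 2γ)(1 - 3γ) = 1 - γ - 6γ²` is below `1 - γ`: no
  -- drift. Without edge, `(1 + 2γ) - (1 - γ) = 3γ` gives drift at most `6γ² / k` per round.
  have hedge : ∀ u ∈ Set.Icc (0 : ℝ) 1,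
      (2 * γ + (2 * γ) ^ 2) * u * ((1 - g) / k) - 2 * γ * (u * ((1 - γ) / k)) ≤ 0 := by
    intro u hu
    have : (2 * γ + (2 * γ) ^ 2) * u * ((1 - g) / k) - 2 * γ * (u * ((1 - γ) / k)) =
        -(12 * γ ^ 3 * u / k) := by
      rw [hg]; field_simp; ring
    rw [this, neg_nonpos]
    exact div_nonneg (mul_nonneg (by positivity) hu.1) hk.le
  have hnone : ∀ u ∈ Set.Icc (0 : ℝ) 1, (2 * γ + (2 * γ) ^ 2) * u * ((1 - (0 : unitInterval)) / k) -
      2 * γ * (u * ((1 - γ) / k)) ≤ 6 * γ ^ 2 / k := by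
    intro u hu
    have : (2 * γ + (2 * γ) ^ 2) * u * ((1 - (0 : unitInterval)) / k) -
        2 * γ * (u * ((1 - γ) / k)) = 6 * γ ^ 2 * u / k := by
      rw [Set.Icc.coe_zero]; field_simp; ring
    rw [this]
    exact div_le_div_of_nonneg_right (mul_le_of_le_one_right (by positivity) hu.2) hk.le
  refine delayedLaw_apply_le (Real.exp_nonneg _) (le_min zero_le_one (Real.exp_nonneg _)) ?_ ?_
  · have h := infinitePi_excess_gt_le B ξ β (fun _ => g) (lam := 2 * γ) (c := (1 - γ) / k)
      (b := fun _ => 0) (by linarith) (by linarith) (fun _ => hedge) i T S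
    simpa using h
  · rw [ENNReal.ofReal_min, ENNReal.ofReal_one]
    -- The trivial bound 1 is kept for the case in which `S` cannot pay for a single round without
    -- edge.
    refine le_min prob_le_one ?_
    refine (infinitePi_excess_gt_le B ξ β (fun t => if t < τ then 0 else g) (lam := 2 * γ)
      (c := (1 - γ) / k) (b := fun t => if t < τ then 6 * γ ^ 2 / k else 0) (by linarith)
      (by linarith) (fun t => ?_) i T S).trans
      (ENNReal.ofReal_le_ofReal (Real.exp_le_exp.2 (sub_le_sub_right ?_ _)))
    · split_ifs
      · exact hnone
      · exact hedge
    · rw [← Finset.sum_filter, Finset.sum_const, nsmul_eq_mul]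
      gcongr
      calc _ ≤ (Finset.range τ).card := Finset.card_le_card fun t ht => by
            simpa using (Finset.mem_filter.1 ht).2
        _ = τ := Finset.card_range τ

lemma infinitePi_errors_le_le (hk : 2 ≤ k) (g : ℕ → unitInterval) {p : ℝ}
    (hg : ∀ t, (g t : ℝ) ≤ 3 / 4)
    (hp : ∀ t, p ≤ 1 / 4 * Real.exp (-(8 * N * k * (g t : ℝ) ^ 2))) (T : ℕ) :
    Measure.infinitePi (fun t => roundLaw k (g t)) {z | sumRounds (errorAt B ξ β) z T ≤ p / 2 * T} ≤
      ENNReal.ofReal (Real.exp (-(p / 10) * T)) := by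
  have h1 := infinitePi_sumRounds_ge_le g
    (f := fun t h u => -errorAt B ξ β t h u) (b := fun _ => -(3 / 5 * p))
    (fun t => ((measurable_errorAt B t).comp (measurable_id.prodMk
      (measurable_const (a := (ξ, β))))).neg)
    (fun t h => lintegral_exp_neg_errorAt_le B ξ β hk (g t) (hg t) (hp t) t h) T (-(p / 2 * T))
  -- The rate `1 / 10` is `3 / 5 - 1 / 2`.
  have hexp : ∑ _t ∈ Finset.range T, -(3 / 5 * p) - -(p / 2 * T) = -(p / 10) * T := by
    rw [Finset.sum_const, Finset.card_range, nsmul_eq_mul]; ring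
  rw [hexp] at h1
  refine (measure_mono fun z hz => ?_).trans h1
  have hz' : sumRounds (errorAt B ξ β) z T ≤ p / 2 * T := hz
  change -(p / 2 * T) ≤ ∑ t ∈ Finset.range T, -errorAt B ξ β t (fun s => z s) (z t)
  rw [Finset.sum_neg_distrib]
  exact neg_le_neg hz'

lemma delayedLaw_errors_le_le (hk : 2 ≤ k) {p : ℝ} (hg : (g : ℝ) ≤ 3 / 4)
    (hp : p ≤ 1 / 4 * Real.exp (-(8 * N * k * (g : ℝ) ^ 2))) (T : ℕ) :
    delayedLaw k g τ {z | sumRounds (errorAt B ξ β) z T ≤ p / 2 * T} ≤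
      ENNReal.ofReal (Real.exp (-(p / 10) * T)) := by
  have hp0 : p ≤ 1 / 4 * Real.exp (-(8 * N * k * ((0 : unitInterval) : ℝ) ^ 2)) := by
    refine hp.trans (mul_le_mul_of_nonneg_left (Real.exp_le_exp.2 (neg_le_neg ?_)) (by norm_num))
    have : 0 ≤ 8 * N * k * (g : ℝ) ^ 2 := by positivity
    simpa using this
  have h := delayedLaw_apply_le (k := k) (g := g) (τ := τ) (Real.exp_nonneg (-(p / 10) * T))
    (Real.exp_nonneg (-(p / 10) * T))
    (infinitePi_errors_le_le B ξ β hk (fun _ => g) (fun _ => hg) (fun _ => hp) T)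
    (infinitePi_errors_le_le B ξ β hk (fun t => if t < τ then 0 else g)
      (fun t => by split_ifs <;> [norm_num; exact hg])
      (fun t => by split_ifs <;> assumption) T)
  refine h.trans_eq ?_
  congr 1; ring

/-- Each of these rounds contributes at most `1/3 · 1 + 2/3 · 1/2 = 2/3`, as blind guessing succeeds
with probability `1 / k ≤ 1 / 2`. -/
lemma delayedLaw_lintegral_correct_le (hk : 2 ≤ k) {n : ℕ} (hn : n ≤ τ) :
    ∫⁻ z, ENNReal.ofReal (sumRounds (fun t h u => 1 - errorAt B ξ β t h u) z n)
      ∂delayedLaw k g τ ≤ ENNReal.ofReal (2 / 3 * n) := by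
  have h1 := lintegral_sum_correct_le B ξ β (fun _ => g) (c := 1) n fun t _ h => by
    rw [ENNReal.ofReal_one]; exact lintegral_one_sub_errorAt_le_one B ξ β g t h
  have h2 := lintegral_sum_correct_le B ξ β (fun t => if t < τ then 0 else g) (c := 1 / 2) n
    fun t ht h => by
      rw [if_pos (ht.trans_le hn)]
      refine (lintegral_one_sub_errorAt_le B ξ β t h).trans (ENNReal.ofReal_le_ofReal ?_)
      exact one_div_le_one_div_of_le (by norm_num) (by exact_mod_cast hk)
  refine (lintegral_delayedLaw_le (by positivity) (by positivity) h1 h2).trans_eq ?_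
  congr 1; ring

end Mixture

/-! ### Choice of the delay and numerical estimates. -/

section Parameters

/-- The number of rounds in which the votes may have no edge. -/
noncomputable def delay (k : ℕ) (γ S : ℝ) : ℕ := max 1 ⌊k * S / (6 * γ)⌋₊

/-- Rounding down loses at most half because of the `max 1`: both `1` and `⌊x⌋` are at most the
delay, and their sum exceeds `x`. -/
lemma le_delay (k : ℕ) (γ S : ℝ) : k * S / (12 * γ) ≤ delay k γ S := by
  have h1 : (1 : ℝ) ≤ delay k γ S := by exact_mod_cast le_max_left 1 _
  have h2 : (⌊k * S / (6 * γ)⌋₊ : ℝ) ≤ delay k γ S := by exact_mod_cast le_max_right 1 _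
  have h3 := Nat.lt_floor_add_one (k * S / (6 * γ))
  have h4 : k * S / (12 * γ) = k * S / (6 * γ) / 2 := by
    rw [div_div]; congr 1; ring
  rw [h4]
  linarith

lemma failure_probability_le {k : ℕ} {γ δ S : ℝ} (hk : 2 ≤ k) (hγ : 0 < γ) (hγ4 : γ < 1 / 4)
    (hδ : 0 < δ) (hδ1 : δ < 1) (hS : k * Real.log (1 / δ) / γ ≤ S) :
    1 / 3 * Real.exp (-(2 * γ * S)) +
      2 / 3 * min 1 (Real.exp (delay k γ S * (6 * γ ^ 2 / k) - 2 * γ * S)) ≤ δ := by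
  have hk2 : (2 : ℝ) ≤ k := by exact_mod_cast hk
  set L := Real.log (1 / δ) with hL
  have hLδ : Real.exp (-L) = δ := by
    rw [hL, one_div, Real.log_inv, neg_neg, Real.exp_log hδ]
  have hL0 : 0 ≤ L := Real.log_nonneg (by rw [le_div_iff₀ hδ]; linarith)
  have hS' : k * L ≤ γ * S := by rwa [div_le_iff₀' hγ] at hS
  have hLS : 2 * L ≤ γ * S := (mul_le_mul_of_nonneg_right hk2 hL0).trans hS'
  rcases le_or_gt 1 (k * S / (6 * γ)) with h | h
  -- The drift over the delay uses up at most `γ * S` of the exponent `2γS`; the remaining `γ * S ≥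
  -- 2 * L` yields `δ`.
  · have hd : (delay k γ S : ℝ) ≤ k * S / (6 * γ) := by
      have h0 : 1 ≤ ⌊k * S / (6 * γ)⌋₊ := Nat.le_floor (by simpa using h)
      rw [delay, max_eq_right h0]
      exact Nat.floor_le (by linarith)
    have h1 : delay k γ S * (6 * γ ^ 2 / k) ≤ γ * S := by
      calc _ ≤ k * S / (6 * γ) * (6 * γ ^ 2 / k) := by gcongr
        _ = γ * S := by field_simp
    have h2 : Real.exp (delay k γ S * (6 * γ ^ 2 / k) - 2 * γ * S) ≤ δ := by
      rw [← hLδ, Real.exp_le_exp]; linarith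
    have h3 : Real.exp (-(2 * γ * S)) ≤ δ := by
      rw [← hLδ, Real.exp_le_exp]; linarith
    linarith [min_le_right 1 (Real.exp (delay k γ S * (6 * γ ^ 2 / k) - 2 * γ * S))]
  -- Now the delay is one round and the second branch may always fail. But a small `S` forces `L ≤ 1
  -- / 10`, hence `δ ≥ 9 / 10`, and `δ⁴ / 3 + 2 / 3 ≤ δ`.
  · have h1 : Real.exp (-(2 * γ * S)) ≤ δ ^ 4 := by
      rw [← hLδ, ← Real.exp_nat_mul, Real.exp_le_exp]; push_cast; linarith
    have hδ9 : 9 / 10 ≤ δ := by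
      rw [div_lt_one (by positivity)] at h
      have h2 : k * (k * L) ≤ 6 * γ ^ 2 := by
        calc k * (k * L) ≤ k * (γ * S) := by gcongr
          _ = γ * (k * S) := by ring
          _ ≤ γ * (6 * γ) := by gcongr
          _ = 6 * γ ^ 2 := by ring
      have h3 : L ≤ 1 / 10 := by nlinarith
      rw [← hLδ]
      linarith [Real.add_one_le_exp (-L)]
    have h2 := min_le_left 1 (Real.exp (delay k γ S * (6 * γ ^ 2 / k) - 2 * γ * S))
    have h3 : δ ^ 4 - 3 * δ + 2 ≤ 0 := by
      have : δ ^ 4 - 3 * δ + 2 = -((1 - δ) * (δ ^ 3 + δ ^ 2 + δ - 2)) := by ring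
      rw [this, neg_nonpos]
      refine mul_nonneg (by linarith) ?_
      have h4 : (9 / 10 : ℝ) ^ 3 ≤ δ ^ 3 := by gcongr
      have h5 : (9 / 10 : ℝ) ^ 2 ≤ δ ^ 2 := by gcongr
      norm_num at h4 h5
      linarith
    linarith

lemma lt_error_probability {k N : ℕ} {γ ε : ℝ} (hk : 2 ≤ k) (hγ : 0 < γ) (hε : 0 < ε)
    (hε1 : ε ≤ 1 / 100)
    (hN : N < 1 / 108 * (1 / ((k : ℝ) ^ 2 * γ ^ 2) * Real.log (1 / ε))) :
    ε < 1 / 4 * Real.exp (-(8 * N * k * (3 * γ) ^ 2)) / 2 := by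
  have hk2 : (2 : ℝ) ≤ k := by exact_mod_cast hk
  set L := Real.log (1 / ε) with hL
  have hLε : Real.exp (-L) = ε := by
    rw [hL, one_div, Real.log_inv, neg_neg, Real.exp_log hε]
  have hL0 : 0 ≤ L := Real.log_nonneg (by rw [le_div_iff₀ hε]; linarith)
  have h1 : 108 * (N * (k ^ 2 * γ ^ 2)) ≤ L := by
    have hpos : 0 < (k : ℝ) ^ 2 * γ ^ 2 := by positivity
    have h2 := mul_le_mul_of_nonneg_right hN.le hpos.le
    have h3 : 1 / 108 * (1 / ((k : ℝ) ^ 2 * γ ^ 2) * L) * (k ^ 2 * γ ^ 2) = L / 108 := by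
      field_simp
    rw [h3] at h2
    linarith
  -- The exponent is `72Nkγ²`, with a single factor `k`; the second one in the theorem is given away
  -- through `2 ≤ k`.
  have h2 : 8 * N * k * (3 * γ) ^ 2 ≤ L / 2 := by
    have h3 : 2 * (N * k * γ ^ 2) ≤ k * (N * k * γ ^ 2) := by gcongr
    nlinarith
  have hs : Real.exp (-(L / 2)) ^ 2 = ε := by
    rw [← Real.exp_nat_mul, ← hLε]; congr 1; push_cast; ring
  have h3 : Real.exp (-(L / 2)) ≤ Real.exp (-(8 * N * k * (3 * γ) ^ 2)) :=
    Real.exp_le_exp.2 (neg_le_neg h2)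
  have h4 := Real.exp_pos (-(L / 2))
  -- The claim reduces to `ε < √ε / 8`, which `√ε ≤ 1 / 10` ensures; hence the threshold `1 / 100`.
  have h5 : Real.exp (-(L / 2)) ≤ 1 / 10 := by nlinarith
  nlinarith

end Parameters

end OnlineBoosting

theorem theorem2 :
    ∃ c : ℝ, 0 < c ∧ ∃ ε₀ : ℝ, 0 < ε₀ ∧
      ∀ (k : ℕ) (γ δ ε S : ℝ), 2 ≤ k → 0 < γ → γ < 1 / 4 → 0 < δ → δ < 1 →
        0 < ε → ε < 1 → ε ≤ ε₀ → k * Real.log (1 / δ) / γ ≤ S →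
        ∃ E : OnlineBoosting.Environment k,
          E.WeakLearningCondition δ γ S ∧
          ∀ (N : ℕ) (B : OnlineBoosting.Booster E.X k N),
            (E.ReachesAsymptoticErrorRate B ε →
              c * (1 / ((k : ℝ) ^ 2 * γ ^ 2) * Real.log (1 / ε)) ≤ N) ∧
            (∀ T : ℕ, 1 ≤ T → E.HasErrorRateAfter B T ε →
              c * (k / (ε * γ) * S) ≤ T) := by
  -- `108 = 12 · 9`: the `12` is from `le_delay`, the `9` from `h2` in the second part. The first
  -- part has slack.
  refine ⟨1 / 108, by norm_num, 1 / 100, by norm_num, ?_⟩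
  intro k γ δ ε S hk hγ hγ4 hδ hδ1 hε _ hε₀ hS
  have : NeZero k := ⟨by omega⟩
  set g : unitInterval := ⟨3 * γ, by linarith, by linarith⟩
  have hgγ : (g : ℝ) = 3 * γ := rfl
  set τ := OnlineBoosting.delay k γ S
  refine ⟨OnlineBoosting.maskedEnvironment
    (OnlineBoosting.delayedLaw k g τ), ?_, ?_⟩
  · refine OnlineBoosting.weakLearningCondition_maskedEnvironment
      (OnlineBoosting.delayedLaw k g τ) (fun N B ξ β T i => ?_) hδ.le
    exact (OnlineBoosting.delayedLaw_excess_gt_le B ξ β hγ hγ4 hgγ i T S).trans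
      (ENNReal.ofReal_le_ofReal (OnlineBoosting.failure_probability_le hk hγ hγ4 hδ hδ1 hS))
  · intro N B
    constructor
    · intro hreach
      by_contra! hN
      set p := 1 / 4 * Real.exp (-(8 * N * k * (3 * γ) ^ 2))
      have hp0 : 0 < p := by positivity
      exact OnlineBoosting.not_reachesAsymptoticErrorRate
        (OnlineBoosting.delayedLaw k g τ) B (a := p / 2) (b := p / 10)
        (by positivity) (OnlineBoosting.lt_error_probability hk hγ hε hε₀ hN)
        (fun ξ β T => OnlineBoosting.delayedLaw_errors_le_le B ξ β hk (by linarith) le_rfl T)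
        hreach
    · intro T hT herr
      have h1 := OnlineBoosting.le_of_hasErrorRateAfter
        (OnlineBoosting.delayedLaw k g τ) B (min_le_left T τ)
        (fun ξ β => OnlineBoosting.delayedLaw_lintegral_correct_le B ξ β hk (min_le_right T τ))
        (by positivity) herr
      have hT1 : (1 : ℝ) ≤ T := by exact_mod_cast hT
      -- For `n = min T τ`, the bound `3/4 · (n - εT) ≤ 2/3 · n` rearranges to this.
      have h2 : ((min T τ : ℕ) : ℝ) ≤ 9 * (ε * T) := by linarith
      rcases le_total T τ with hTτ | hTτ
      -- A `T` within the delay is impossible, since `9 * ε < 1`.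
      · rw [min_eq_left hTτ] at h2
        nlinarith
      · rw [min_eq_right hTτ] at h2
        have h3 := (OnlineBoosting.le_delay k γ S).trans h2
        have h4 : 1 / 108 * (k / (ε * γ) * S) = k * S / (12 * γ) / (9 * ε) := by
          field_simp; ring
        rw [h4, div_le_iff₀ (by positivity)]
        linarith
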